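/- Let $k\geq 1$ be an integer. A finite set $A\subset\mathbb R$ is called well spaced if $|s-t|\geq 1$ for all distinct $s,t\in A$, and its additive $k$-energy is $$T_k(A)=\#\{(t_1,\dots,t_{2k})\in A^{2k} : |t_1+\dots+t_k-t_{k+1}-\dots-t_{2k}|\leq 1\}.$$ For real $N\geq 1$, complex numbers $(a_n)$ and $A$ as above put $$S=\sum_{t_1,\dots,t_{2k}\in A}\Bigl|\sum_{N\leq n\leq 2N}a_n\,n^{-1/2+i(t_1+\dots+t_k-t_{k+1}-\dots-t_{2k})}\Bigr|^2 .$$ (1) For every $\varepsilon>0$ and $B>0$ there is a constant $C=C(k,\varepsilon,B)$ such that for all real $N,T\geq 1$ with $T\leq N^{B}$, all well spaced $A\subset[0,T]$ and all complex $(a_n)$ with $|a_n|\leq 1$, $$S\leq C N^{\varepsilon}\left(|A|^{2k}+N\,T_k(A)+T^{1/2}|A|^{k/2}T_k(A)^{3/4}\right).$$ (2) For every $\varepsilon>0$ there is a constant $C=C(k,\varepsilon)$ such that for all real $N,T\geq 1$, all well spaced $A\subset[0,T]$ and all complex $(a_n)$ with $|a_n|\leq 1$: if $N\geq T^{2/3}$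 or $T^{2/3}T_k(A)\leq |A|^{2k}$, then $$S\leq C (NT)^{\varepsilon}\left(|A|^{2k}+N\,T_k(A)\right).$$ -/

import Mathlib

/-- A finite set of reals is well spaced (that is, 1-spaced) if any two distinct points of it are
at distance at least `1`. -/
def IsWellSpaced (A : Finset ℝ) : Prop :=
  ∀ s ∈ A, ∀ t ∈ A, s ≠ t → 1 ≤ |s - t|

/-- The `k`-tuples of elements of `A`. -/
def tuples (A : Finset ℝ) (k : ℕ) : Finset (Fin k → ℝ) :=
  Fintype.piFinset fun _ => A

/-- The additive `k`-energy: the number of `2k`-tuples `(t₁, …, t₂ₖ)` of elements of `A` with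
`|t₁ + ⋯ + tₖ - tₖ₊₁ - ⋯ - t₂ₖ| ≤ 1`. Such a tuple is recorded as the pair of its two halves. -/
noncomputable def additiveEnergy (k : ℕ) (A : Finset ℝ) : ℕ :=
  ((tuples A k ×ˢ tuples A k).filter fun p => |(∑ i, p.1 i) - ∑ i, p.2 i| ≤ 1).card

/-- The Dirichlet polynomial `∑_{N ≤ n ≤ 2N} aₙ n^{-1/2 + iτ}`, over the integers `n` in the real
interval `[N, 2N]`. -/
noncomputable def dirichletPoly (a : ℕ → ℂ) (N τ : ℝ) : ℂ :=
  ∑ n ∈ Finset.Icc ⌈N⌉₊ ⌊2 * N⌋₊, a n * (n : ℂ) ^ (-1 / 2 + (τ : ℂ) * Complex.I)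

/-- The mean value `∑ |∑_{N ≤ n ≤ 2N} aₙ n^{-1/2 + i(t₁ + ⋯ + tₖ - tₖ₊₁ - ⋯ - t₂ₖ)}|²` over all
`2k`-tuples `(t₁, …, t₂ₖ)` of elements of `A`. -/
noncomputable def convolutionMeanValue (k : ℕ) (A : Finset ℝ) (a : ℕ → ℂ) (N : ℝ) : ℝ :=
  ∑ u ∈ tuples A k, ∑ v ∈ tuples A k, ‖dirichletPoly a N ((∑ i, u i) - ∑ i, v i)‖ ^ 2

/-! Let U(M) stand for `zetaMeanSquare`, the sum of |∑_{n ≤ M} n^(-1/2 + iτ)|² over all differences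
τ of the points t₁ + ⋯ + tₖ, one point for each k-tuple. Put W = |A|^k, the number of points, and E
= T_k(A), the number of pairs of points at distance at most 1.

When the square is expanded, the sum over pairs of points factorises, and a_m conj(a_n) receives the
nonnegative weight |∑_u (m/n)^(i x_u)|². This gives the majorant principle
`meanSquare_le_of_norm_le`: enlarging the coefficients enlarges the mean square. It reduces the
theorem to bounding U(2N), and it later disposes of smooth weights, divisor-function coefficients
and twists n^(-iy).

Up to factors (NT)^ε two inequalities hold. Squaring (`zetaMeanSquare_sq_le`): U(M)² ≤ W² U(M²), by
Cauchy-Schwarz and the divisor bound. Reflection (`exists_meanSquare_upperHalf_le`): U(N) ≤ NE + W²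
+ U(T/N). The range [1, N] is replaced by (N/2, N], smoothed by exp(-log²(y/N)), and Poisson
summation is applied. The zero frequency is concentrated at small τ and gives NE. The other
frequencies, expressed through the Gamma function, form a Gaussian average of Dirichlet polynomials
of length about T/N.

If N ≥ T^(2/3), then (T/N)² ≤ N, so the two inequalities combine to U(N) ≤ NE + W² + W U(N)^(1/2),
whence U(N) ≤ NE + W². Since U is monotone, U(N) ≤ W² + NE + T^(2/3) E for every N
(`le_of_reflection_of_squaring`). In both cases of (2) the last term is absorbed.

For (1), reflection at a length M ≥ N, squaring, and the previous bound applied to U((T/M)²) cost ME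
and W (T/M) E^(1/2), besides harmless terms. These balance at ME = T^(1/2) W^(1/2) E^(3/4), which is
the third term of (1) (`le_of_reflection_of_squaring'`). -/

/-! ### Mean squares over differences and the majorant principle. -/

/-- Sum over pairs of points of the squared modulus of a Dirichlet polynomial at their
difference. -/
noncomputable def meanSquare {ι : Type*} (I : Finset ι) (x : ι → ℝ) (J : Finset ℕ) (a : ℕ → ℂ) :
    ℝ :=
  ∑ u ∈ I, ∑ v ∈ I, ‖∑ n ∈ J, a n * (n : ℂ) ^ (((x u - x v : ℝ) : ℂ) * Complex.I)‖ ^ 2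

/-- The squared modulus of `∑ (m / n) ^ (i x_u)`. -/
noncomputable def ratioKernel {ι : Type*} (I : Finset ι) (x : ι → ℝ) (m n : ℕ) : ℝ :=
  ‖∑ u ∈ I, (m : ℂ) ^ ((x u : ℂ) * Complex.I) * (n : ℂ) ^ (-(x u : ℂ) * Complex.I)‖ ^ 2

lemma ratioKernel_nonneg {ι : Type*} (I : Finset ι) (x : ι → ℝ) (m n : ℕ) :
    0 ≤ ratioKernel I x m n := by
  unfold ratioKernel; positivity

lemma meanSquare_nonneg {ι : Type*} (I : Finset ι) (x : ι → ℝ) (J : Finset ℕ) (a : ℕ → ℂ) :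
    0 ≤ meanSquare I x J a := by
  unfold meanSquare; positivity

lemma conj_natCast_cpow_mul_I (n : ℕ) (y : ℝ) :
    (starRingEnd ℂ) ((n : ℂ) ^ ((y : ℂ) * Complex.I)) = (n : ℂ) ^ (-(y : ℂ) * Complex.I) := by
  have h := Complex.cpow_conj (n : ℂ) ((y : ℂ) * Complex.I)
    (by simpa [Complex.natCast_arg] using Real.pi_pos.ne)
  rw [Complex.conj_natCast] at h
  simp [← h]

lemma natCast_cpow_sub_mul_I {n : ℕ} (hn : n ≠ 0) (y z : ℝ) :
    (n : ℂ) ^ (((y - z : ℝ) : ℂ) * Complex.I) =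
      (n : ℂ) ^ ((y : ℂ) * Complex.I) * (n : ℂ) ^ (-(z : ℂ) * Complex.I) := by
  rw [← Complex.cpow_add _ _ (by exact_mod_cast hn)]
  congr 1; push_cast; ring

/-- The phase (m/n)^(i(x_u - x_v)) is a function of u times the conjugate of the same function of v,
so for fixed m and n the double sum over points is a squared modulus. The positivity of this kernel
is what drives the whole proof. -/
lemma meanSquare_eq_sum_ratioKernel {ι : Type*} (I : Finset ι) (x : ι → ℝ) {J : Finset ℕ}
    (hJ : 0 ∉ J) (a : ℕ → ℂ) :
    (meanSquare I x J a : ℂ) =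
      ∑ m ∈ J, ∑ n ∈ J, a m * (starRingEnd ℂ) (a n) * (ratioKernel I x m n : ℂ) := by
  have hne : ∀ n ∈ J, n ≠ 0 := fun n hn h => hJ (h ▸ hn)
  have key : ∀ u v, ((‖∑ n ∈ J, a n * (n : ℂ) ^ (((x u - x v : ℝ) : ℂ) * Complex.I)‖ ^ 2 : ℝ) : ℂ) =
      ∑ m ∈ J, ∑ n ∈ J, a m * (starRingEnd ℂ) (a n) *
        (((m : ℂ) ^ ((x u : ℂ) * Complex.I) * (n : ℂ) ^ (-(x u : ℂ) * Complex.I)) *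
         ((n : ℂ) ^ ((x v : ℂ) * Complex.I) * (m : ℂ) ^ (-(x v : ℂ) * Complex.I))) := by
    intro u v
    rw [Complex.ofReal_pow, ← Complex.mul_conj', map_sum, Finset.sum_mul_sum]
    refine Finset.sum_congr rfl fun m hm => Finset.sum_congr rfl fun n hn => ?_
    rw [map_mul, natCast_cpow_sub_mul_I (hne m hm), natCast_cpow_sub_mul_I (hne n hn), map_mul,
      conj_natCast_cpow_mul_I, ← conj_natCast_cpow_mul_I n (x v), Complex.conj_conj]
    ring
  unfold meanSquare
  simp_rw [Complex.ofReal_sum, key]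
  rw [Finset.sum_congr rfl fun u _ => Finset.sum_comm, Finset.sum_comm]
  refine Finset.sum_congr rfl fun m hm => ?_
  rw [Finset.sum_congr rfl fun u _ => Finset.sum_comm, Finset.sum_comm]
  refine Finset.sum_congr rfl fun n hn => ?_
  unfold ratioKernel
  push_cast
  rw [← Complex.mul_conj', map_sum, Finset.sum_mul_sum, Finset.mul_sum]
  refine Finset.sum_congr rfl fun u hu => ?_
  rw [Finset.mul_sum]
  refine Finset.sum_congr rfl fun v hv => ?_
  rw [map_mul, conj_natCast_cpow_mul_I, ← conj_natCast_cpow_mul_I n (x v), Complex.conj_conj]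
  ring

lemma meanSquare_ofReal {ι : Type*} (I : Finset ι) (x : ι → ℝ) {J : Finset ℕ}
    (hJ : 0 ∉ J) (b : ℕ → ℝ) :
    meanSquare I x J (fun n => (b n : ℂ)) =
      ∑ m ∈ J, ∑ n ∈ J, b m * b n * ratioKernel I x m n := by
  have := meanSquare_eq_sum_ratioKernel I x hJ (fun n => (b n : ℂ))
  simp only [Complex.conj_ofReal] at this
  exact_mod_cast this

/-- The majorant principle: the mean square over differences grows with the coefficients. -/
lemma meanSquare_le_of_norm_le {ι : Type*} (I : Finset ι) (x : ι → ℝ) {J J' : Finset ℕ}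
    (hJJ : J ⊆ J') (hJ : 0 ∉ J') {a : ℕ → ℂ} {b : ℕ → ℝ} (hab : ∀ n ∈ J, ‖a n‖ ≤ b n)
    (hb : ∀ n ∈ J', 0 ≤ b n) :
    meanSquare I x J a ≤ meanSquare I x J' (fun n => (b n : ℂ)) := by
  rw [meanSquare_ofReal I x hJ]
  have h1 := meanSquare_eq_sum_ratioKernel I x (fun h => hJ (hJJ h)) a
  calc meanSquare I x J a = ‖(meanSquare I x J a : ℂ)‖ := by
        rw [Complex.norm_real, Real.norm_of_nonneg (meanSquare_nonneg ..)]
    _ ≤ ∑ m ∈ J, ∑ n ∈ J, b m * b n * ratioKernel I x m n := by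
        rw [h1]
        refine (norm_sum_le _ _).trans (Finset.sum_le_sum fun m hm => ?_)
        refine (norm_sum_le _ _).trans (Finset.sum_le_sum fun n hn => ?_)
        rw [norm_mul, norm_mul, RCLike.norm_conj, Complex.norm_real,
          Real.norm_of_nonneg (ratioKernel_nonneg ..)]
        gcongr
        · exact ratioKernel_nonneg ..
        · exact (norm_nonneg _).trans (hab m hm)
        · exact hab m hm
        · exact hab n hn
    _ ≤ ∑ m ∈ J', ∑ n ∈ J', b m * b n * ratioKernel I x m n := by
        have hpos : ∀ m ∈ J', ∀ n ∈ J', 0 ≤ b m * b n * ratioKernel I x m n := fun m hm n hn =>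
          mul_nonneg (mul_nonneg (hb m hm) (hb n hn)) (ratioKernel_nonneg ..)
        refine (Finset.sum_le_sum fun m hm => Finset.sum_le_sum_of_subset_of_nonneg hJJ
          fun n hn _ => hpos m (hJJ hm) n hn).trans ?_
        exact Finset.sum_le_sum_of_subset_of_nonneg hJJ
          fun m hm _ => Finset.sum_nonneg fun n hn => hpos m hm n hn

lemma meanSquare_const_mul {ι : Type*} (I : Finset ι) (x : ι → ℝ) (J : Finset ℕ) (c : ℂ)
    (a : ℕ → ℂ) : meanSquare I x J (fun n => c * a n) = ‖c‖ ^ 2 * meanSquare I x J a := by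
  unfold meanSquare
  simp_rw [Finset.mul_sum, mul_assoc, ← Finset.mul_sum, norm_mul, mul_pow, Finset.mul_sum]

/-! ### The divisor bound. -/

/-- The divisor bound. -/
lemma exists_card_divisors_le_rpow {ε : ℝ} (hε : 0 < ε) :
    ∃ C : ℝ, 1 ≤ C ∧ ∀ n : ℕ, n ≠ 0 → (n.divisors.card : ℝ) ≤ C * (n : ℝ) ^ ε := by
  have hl2 : 0 < Real.log 2 := Real.log_pos (by norm_num)
  set C₀ : ℝ := 1 + 1 / (ε * Real.log 2) with hC₀
  have hC₀1 : 1 ≤ C₀ := by rw [hC₀]; have : 0 < 1 / (ε * Real.log 2) := by positivity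
                           linarith
  -- For p ≥ P one has p^ε ≥ 2, so α + 1 ≤ 2^α ≤ p^(εα) without loss. Each of the fewer than P
  -- smaller primes loses at most C₀, by Bernoulli's inequality.
  set P : ℕ := ⌈(2 : ℝ) ^ (1 / ε)⌉₊ with hP
  refine ⟨C₀ ^ P, one_le_pow₀ hC₀1, fun n hn => ?_⟩
  have hfac : ∀ p ∈ n.primeFactors, ((n.factorization p + 1 : ℕ) : ℝ) ≤
      (if p < P then C₀ else 1) * ((p : ℝ) ^ n.factorization p) ^ ε := by
    intro p hp
    have hp2 : (2 : ℝ) ≤ p := by exact_mod_cast (Nat.prime_of_mem_primeFactors hp).two_le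
    set α := n.factorization p
    have hcomm : ((p : ℝ) ^ α) ^ ε = ((p : ℝ) ^ ε) ^ α := by
      rw [← Real.rpow_natCast, ← Real.rpow_natCast, ← Real.rpow_mul (by positivity),
        ← Real.rpow_mul (by positivity), mul_comm]
    rw [hcomm]
    split_ifs with h
    · have h1 : (2 : ℝ) ^ ε ≤ (p : ℝ) ^ ε := by gcongr
      have h2 : 1 + ε * Real.log 2 ≤ (2 : ℝ) ^ ε := by
        rw [Real.rpow_def_of_pos (by norm_num)]
        have := Real.add_one_le_exp (Real.log 2 * ε)
        linarith
      have h3 : 1 + (α : ℝ) * (ε * Real.log 2) ≤ ((p : ℝ) ^ ε) ^ α :=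
        (one_add_mul_le_pow (by have : 0 < ε * Real.log 2 := by positivity
                                linarith) α).trans (by gcongr; linarith)
      calc ((α + 1 : ℕ) : ℝ) ≤ C₀ * (1 + (α : ℝ) * (ε * Real.log 2)) := by
            push_cast
            rw [hC₀]
            have : 1 / (ε * Real.log 2) * (α * (ε * Real.log 2)) = α := by field_simp
            have h4 : 0 < 1 / (ε * Real.log 2) := by positivity
            have h5 : 0 ≤ (α : ℝ) * (ε * Real.log 2) := by positivity
            nlinarith
        _ ≤ _ := by gcongr
    · rw [one_mul]
      have h1 : (2 : ℝ) ≤ (p : ℝ) ^ ε := by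
        have : (2 : ℝ) ^ (1 / ε) ≤ p := (Nat.le_ceil _).trans (by exact_mod_cast not_lt.mp h)
        calc (2 : ℝ) = ((2 : ℝ) ^ (1 / ε)) ^ ε := by
              rw [← Real.rpow_mul (by norm_num), one_div_mul_cancel hε.ne', Real.rpow_one]
          _ ≤ _ := by gcongr
      calc ((α + 1 : ℕ) : ℝ) ≤ 2 ^ α := by exact_mod_cast (Nat.lt_two_pow_self (n := α))
        _ ≤ _ := by gcongr
  rw [Nat.card_divisors hn]
  push_cast
  calc ∏ p ∈ n.primeFactors, ((n.factorization p : ℝ) + 1)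
      ≤ ∏ p ∈ n.primeFactors, ((if p < P then C₀ else 1) * ((p : ℝ) ^ n.factorization p) ^ ε) :=
        Finset.prod_le_prod (fun _ _ => by positivity) fun p hp => by
          simpa using hfac p hp
    _ = (∏ p ∈ n.primeFactors, (if p < P then C₀ else 1)) *
          (∏ p ∈ n.primeFactors, (p : ℝ) ^ n.factorization p) ^ ε := by
        rw [Finset.prod_mul_distrib, Real.finsetProd_rpow _ _ (fun _ _ => by positivity)]
    _ ≤ C₀ ^ P * (n : ℝ) ^ ε := by
        have h1 : (∏ p ∈ n.primeFactors, (p : ℝ) ^ n.factorization p) = n := by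
          exact_mod_cast Nat.prod_factorization_pow_eq_self hn
        rw [h1]
        gcongr
        rw [← Finset.prod_filter, Finset.prod_const]
        refine pow_le_pow_right₀ hC₀1 ?_
        calc _ ≤ (Finset.range P).card := Finset.card_le_card fun p hp => by
              simpa using (Finset.mem_filter.mp hp).2
          _ = P := Finset.card_range P

/-! ### Squaring: from length M to length M². -/

/-- Mean square of `∑_{n ≤ M} n ^ (-1/2 + iτ)` over differences `τ` of the points `x u`. -/
noncomputable def zetaMeanSquare {ι : Type*} (I : Finset ι) (x : ι → ℝ) (M : ℝ) : ℝ :=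
  meanSquare I x (Finset.Icc 1 ⌊M⌋₊) fun n => (((√n)⁻¹ : ℝ) : ℂ)

lemma zetaMeanSquare_nonneg {ι : Type*} (I : Finset ι) (x : ι → ℝ) (M : ℝ) :
    0 ≤ zetaMeanSquare I x M := meanSquare_nonneg ..

lemma zetaMeanSquare_mono {ι : Type*} (I : Finset ι) (x : ι → ℝ) {M M' : ℝ} (h : M ≤ M') :
    zetaMeanSquare I x M ≤ zetaMeanSquare I x M' := by
  refine meanSquare_le_of_norm_le I x (Finset.Icc_subset_Icc_right (Nat.floor_le_floor h))
    (by simp) (fun n _ => ?_) (fun n _ => by positivity)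
  rw [Complex.norm_real, Real.norm_of_nonneg (by positivity)]

lemma card_mul_eq_le_card_divisors (J : Finset ℕ) {l : ℕ} (hl : l ≠ 0) :
    ((J ×ˢ J).filter fun p => p.1 * p.2 = l).card ≤ l.divisors.card := by
  refine Finset.card_le_card_of_injOn Prod.fst (fun p hp => ?_) ?_
  · have h := (Finset.mem_filter.mp hp).2
    simp only [Finset.mem_coe, Nat.mem_divisors]
    exact ⟨⟨p.2, h.symm⟩, hl⟩
  · rintro ⟨a, b⟩ hp ⟨a', b'⟩ hq h
    have h1 : a * b = l := (Finset.mem_filter.mp hp).2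
    have h2 : a' * b' = l := (Finset.mem_filter.mp hq).2
    obtain rfl : a = a' := h
    have ha : 0 < a := Nat.pos_of_ne_zero fun h0 => hl (by rw [← h1, h0, zero_mul])
    rw [Nat.eq_of_mul_eq_mul_left ha (h1.trans h2.symm)]

lemma meanSquare_sq_le {ι : Type*} (I : Finset ι) (x : ι → ℝ) (J : Finset ℕ) (a : ℕ → ℂ) :
    meanSquare I x J a ^ 2 ≤ (I.card : ℝ) ^ 2 * ∑ u ∈ I, ∑ v ∈ I,
      ‖(∑ n ∈ J, a n * (n : ℂ) ^ (((x u - x v : ℝ) : ℂ) * Complex.I)) ^ 2‖ ^ 2 := by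
  unfold meanSquare
  rw [← Finset.sum_product', ← Finset.sum_product']
  refine sq_sum_le_card_mul_sum_sq.trans ?_
  rw [Finset.card_product, Nat.cast_mul, ← sq]
  simp_rw [norm_pow]
  exact le_rfl

/-- After Cauchy-Schwarz over pairs of points, the square of the polynomial is one of length M²
whose coefficient at l is l^(-1/2) times the number of factorisations of l into two factors at most
M. The majorant principle replaces that number by D. -/
lemma zetaMeanSquare_sq_le {ι : Type*} (I : Finset ι) (x : ι → ℝ) {M D : ℝ} (hM : 0 ≤ M)
    (hD : ∀ n : ℕ, n ≠ 0 → (n : ℝ) ≤ M ^ 2 → (n.divisors.card : ℝ) ≤ D) :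
    zetaMeanSquare I x M ^ 2 ≤ (I.card : ℝ) ^ 2 * (D ^ 2 * zetaMeanSquare I x (M ^ 2)) := by
  refine (meanSquare_sq_le ..).trans ?_
  gcongr
  set J := Finset.Icc 1 ⌊M⌋₊
  set J' := Finset.Icc 1 ⌊M ^ 2⌋₊
  set c : ℕ → ℕ := fun l => ((J ×ˢ J).filter fun p => p.1 * p.2 = l).card with hc
  have hmap : ∀ p ∈ J ×ˢ J, p.1 * p.2 ∈ J' := by
    intro p hp
    obtain ⟨h1, h2⟩ := Finset.mem_product.mp hp
    obtain ⟨h1, h1'⟩ := Finset.mem_Icc.mp h1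
    obtain ⟨h2, h2'⟩ := Finset.mem_Icc.mp h2
    refine Finset.mem_Icc.mpr ⟨Nat.mul_pos h1 h2, Nat.le_floor ?_⟩
    push_cast
    rw [sq]
    exact mul_le_mul ((Nat.le_floor_iff hM).mp h1') ((Nat.le_floor_iff hM).mp h2')
      (by positivity) hM
  have hsq : ∀ τ : ℝ, (∑ n ∈ J, (((√n)⁻¹ : ℝ) : ℂ) * (n : ℂ) ^ ((τ : ℂ) * Complex.I)) ^ 2 =
      ∑ l ∈ J', (((c l : ℝ) * (√l)⁻¹ : ℝ) : ℂ) * (l : ℂ) ^ ((τ : ℂ) * Complex.I) := by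
    intro τ
    rw [sq, Finset.sum_mul_sum, ← Finset.sum_product',
      ← Finset.sum_fiberwise_of_maps_to (t := J') (g := fun p => p.1 * p.2) hmap]
    refine Finset.sum_congr rfl fun l hl => ?_
    have : ∀ p ∈ (J ×ˢ J).filter (fun p => p.1 * p.2 = l),
        (((√p.1)⁻¹ : ℝ) : ℂ) * (p.1 : ℂ) ^ ((τ : ℂ) * Complex.I) *
          ((((√p.2)⁻¹ : ℝ) : ℂ) * (p.2 : ℂ) ^ ((τ : ℂ) * Complex.I)) =
        (((√l)⁻¹ : ℝ) : ℂ) * (l : ℂ) ^ ((τ : ℂ) * Complex.I) := by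
      intro p hp
      rw [← (Finset.mem_filter.mp hp).2, Nat.cast_mul, Nat.cast_mul,
        Complex.natCast_mul_natCast_cpow, Real.sqrt_mul (by positivity), mul_inv]
      push_cast
      ring
    rw [Finset.sum_congr rfl this, Finset.sum_const, nsmul_eq_mul]
    push_cast [hc]
    ring
  simp_rw [hsq]
  have h2 : meanSquare I x J' (fun l => (((c l : ℝ) * (√l)⁻¹ : ℝ) : ℂ)) ≤
      meanSquare I x J' (fun l => ((D * (√l)⁻¹ : ℝ) : ℂ)) := by
    have hcD : ∀ l ∈ J', (c l : ℝ) ≤ D := fun l hl => by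
      obtain ⟨h1, h1'⟩ := Finset.mem_Icc.mp hl
      have hl0 : l ≠ 0 := by omega
      exact le_trans (by exact_mod_cast card_mul_eq_le_card_divisors J hl0)
        (hD l hl0 ((Nat.le_floor_iff (by positivity)).mp h1'))
    refine meanSquare_le_of_norm_le I x (Finset.Subset.refl _) (by simp [J']) (fun l hl => ?_)
      (fun l hl => ?_)
    · rw [Complex.norm_real, Real.norm_of_nonneg (by positivity)]
      gcongr
      exact hcD l hl
    · exact mul_nonneg ((Nat.cast_nonneg _).trans (hcD l hl)) (by positivity)
  refine h2.trans (le_of_eq ?_)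
  simp_rw [Complex.ofReal_mul]
  rw [meanSquare_const_mul, Complex.norm_real, Real.norm_eq_abs, sq_abs]
  rfl

/-! ### Reduction of the range [1, N] to its upper half. -/

/-- With y = N/n ≥ 1, the interval (y/2, y] contains at least y/4 integers h, and each contributes
at least 1/y. So every n ≤ N has multiples hn in (N/2, N] of total weight bounded below. -/
lemma quarter_le_sum_inv {N : ℝ} {n : ℕ} (hn : 1 ≤ n) (hnN : (n : ℝ) ≤ N) :
    1 / 4 ≤ ∑ h ∈ (Finset.Icc 1 ⌊N⌋₊).filter
      (fun h => N / 2 < (h * n : ℕ) ∧ ((h * n : ℕ) : ℝ) ≤ N), (h : ℝ)⁻¹ := by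
  have hn0 : (0 : ℝ) < n := by exact_mod_cast hn
  have hN0 : 0 < N := hn0.trans_le hnN
  have hx1 : 1 ≤ N / n := (one_le_div hn0).mpr hnN
  set y := N / n with hy
  have hsub : Finset.Ioc ⌊y / 2⌋₊ ⌊y⌋₊ ⊆ (Finset.Icc 1 ⌊N⌋₊).filter
      (fun h => N / 2 < (h * n : ℕ) ∧ ((h * n : ℕ) : ℝ) ≤ N) := by
    intro h hh
    obtain ⟨h1, h2⟩ := Finset.mem_Ioc.mp hh
    have h1' : y / 2 < h := (Nat.floor_lt (by positivity)).mp h1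
    have h2' : (h : ℝ) ≤ y := (Nat.le_floor_iff (by positivity)).mp h2
    have hyn : y * n = N := by rw [hy]; field_simp
    have hyN : y ≤ N := by
      rw [← hyn]; exact le_mul_of_one_le_right (by positivity) (by exact_mod_cast hn)
    refine Finset.mem_filter.mpr ⟨Finset.mem_Icc.mpr ⟨by omega, Nat.le_floor (h2'.trans hyN)⟩,
      ?_, ?_⟩
    · push_cast; rw [← hyn]; nlinarith
    · push_cast; rw [← hyn]; nlinarith
  have hcard : y / 4 ≤ ((Finset.Ioc ⌊y / 2⌋₊ ⌊y⌋₊).card : ℝ) := by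
    rw [Nat.card_Ioc, Nat.cast_sub (Nat.floor_le_floor (by linarith))]
    have h1 : ((⌊y / 2⌋₊ : ℕ) : ℝ) ≤ y / 2 := Nat.floor_le (by positivity)
    have h2 : y < ⌊y⌋₊ + 1 := Nat.lt_floor_add_one y
    rcases lt_or_ge y 4 with h4 | h4
    · rcases lt_or_ge y 2 with h5 | h5
      · have : ⌊y / 2⌋₊ = 0 := Nat.floor_eq_zero.mpr (by linarith)
        have h6 : 1 ≤ ⌊y⌋₊ := Nat.le_floor (by simpa using hx1)
        have h6' : (1 : ℝ) ≤ ⌊y⌋₊ := by exact_mod_cast h6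
        rw [this]; push_cast; linarith
      · have : ⌊y / 2⌋₊ < 2 := (Nat.floor_lt (by positivity)).mpr (by push_cast; linarith)
        have h7 : ((⌊y / 2⌋₊ : ℕ) : ℝ) ≤ 1 := by exact_mod_cast Nat.lt_succ_iff.mp this
        have h6 : 2 ≤ ⌊y⌋₊ := Nat.le_floor (by simpa using h5)
        have h6' : (2 : ℝ) ≤ ⌊y⌋₊ := by exact_mod_cast h6
        linarith
    · linarith
  calc (1 : ℝ) / 4 = y / 4 * y⁻¹ := by field_simp
    _ ≤ ((Finset.Ioc ⌊y / 2⌋₊ ⌊y⌋₊).card : ℝ) * y⁻¹ := by gcongr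
    _ = ∑ h ∈ Finset.Ioc ⌊y / 2⌋₊ ⌊y⌋₊, y⁻¹ := by rw [Finset.sum_const, nsmul_eq_mul]
    _ ≤ ∑ h ∈ Finset.Ioc ⌊y / 2⌋₊ ⌊y⌋₊, (h : ℝ)⁻¹ := by
        refine Finset.sum_le_sum fun h hh => ?_
        obtain ⟨h1, h2⟩ := Finset.mem_Ioc.mp hh
        have h2' : (h : ℝ) ≤ y := (Nat.le_floor_iff (by positivity)).mp h2
        have h3 : (0 : ℝ) < h := by exact_mod_cast (Nat.zero_le _).trans_lt h1
        gcongr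
    _ ≤ _ := Finset.sum_le_sum_of_subset_of_nonneg hsub fun _ _ _ => by positivity

/-- The integers in the upper half `(M / 2, M]` of the range `[1, M]`. -/
noncomputable def upperHalf (M : ℝ) : Finset ℕ :=
  (Finset.Icc 1 ⌊M⌋₊).filter fun n => M / 2 < n

lemma mem_upperHalf {M : ℝ} (hM : 0 ≤ M) {n : ℕ} :
    n ∈ upperHalf M ↔ 1 ≤ n ∧ (n : ℝ) ≤ M ∧ M / 2 < n := by
  simp [upperHalf, Nat.le_floor_iff hM, and_assoc]

-- Substitute m = hn: h⁻¹ n^(-1/2) = h^(-1/2) m^(-1/2) and n^(iτ) = h^(-iτ) m^(iτ).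
open Classical in
lemma sum_dvd_rearrange {N : ℝ} (hN : 0 ≤ N) (τ : ℝ) :
    ∑ n ∈ Finset.Icc 1 ⌊N⌋₊, (((∑ h ∈ (Finset.Icc 1 ⌊N⌋₊).filter
        (fun h => N / 2 < (h * n : ℕ) ∧ ((h * n : ℕ) : ℝ) ≤ N), (h : ℝ)⁻¹) * (√n)⁻¹ : ℝ) : ℂ) *
          (n : ℂ) ^ ((τ : ℂ) * Complex.I) =
      ∑ h ∈ Finset.Icc 1 ⌊N⌋₊, ((((√h)⁻¹ : ℝ) : ℂ) * (h : ℂ) ^ (-(τ : ℂ) * Complex.I)) *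
        ∑ m ∈ upperHalf N, ((if h ∣ m then (√m)⁻¹ else 0 : ℝ) : ℂ) *
          (m : ℂ) ^ ((τ : ℂ) * Complex.I) := by
  have hL : ∀ n ∈ Finset.Icc 1 ⌊N⌋₊, (((∑ h ∈ (Finset.Icc 1 ⌊N⌋₊).filter
        (fun h => N / 2 < (h * n : ℕ) ∧ ((h * n : ℕ) : ℝ) ≤ N), (h : ℝ)⁻¹) * (√n)⁻¹ : ℝ) : ℂ) *
          (n : ℂ) ^ ((τ : ℂ) * Complex.I) = ∑ h ∈ Finset.Icc 1 ⌊N⌋₊,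
        if N / 2 < (h * n : ℕ) ∧ ((h * n : ℕ) : ℝ) ≤ N then
          ((((h : ℝ)⁻¹ * (√n)⁻¹ : ℝ)) : ℂ) * (n : ℂ) ^ ((τ : ℂ) * Complex.I) else 0 := by
    intro n _
    rw [Finset.sum_filter, Finset.sum_mul, Complex.ofReal_sum, Finset.sum_mul]
    refine Finset.sum_congr rfl fun h _ => ?_
    split_ifs <;> simp
  rw [Finset.sum_congr rfl hL, Finset.sum_comm]
  refine Finset.sum_congr rfl fun h hh => ?_
  have h1 : 1 ≤ h := (Finset.mem_Icc.mp hh).1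
  have h0 : (0 : ℝ) < h := by exact_mod_cast h1
  rw [Finset.mul_sum, ← Finset.sum_filter]
  have hR : ∀ m ∈ upperHalf N, ((((√h)⁻¹ : ℝ) : ℂ) * (h : ℂ) ^ (-(τ : ℂ) * Complex.I)) *
      (((if h ∣ m then (√m)⁻¹ else 0 : ℝ) : ℂ) * (m : ℂ) ^ ((τ : ℂ) * Complex.I)) =
      if h ∣ m then ((((√h)⁻¹ : ℝ) : ℂ) * (h : ℂ) ^ (-(τ : ℂ) * Complex.I)) *
      ((((√m)⁻¹ : ℝ) : ℂ) * (m : ℂ) ^ ((τ : ℂ) * Complex.I)) else 0 := by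
    intro m _
    split_ifs <;> simp
  rw [Finset.sum_congr rfl hR, ← Finset.sum_filter]
  refine Finset.sum_bij (fun n _ => h * n) ?_ ?_ ?_ ?_
  · intro n hn
    obtain ⟨hn1, hn2, hn3⟩ := Finset.mem_filter.mp hn
    rw [Finset.mem_filter, mem_upperHalf hN]
    exact ⟨⟨Nat.mul_pos h1 (Finset.mem_Icc.mp hn1).1, hn3, hn2⟩, dvd_mul_right _ _⟩
  · intro n _ n' _ hnn
    exact Nat.eq_of_mul_eq_mul_left h1 hnn
  · intro m hm
    obtain ⟨hm1, n, rfl⟩ := Finset.mem_filter.mp hm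
    obtain ⟨hm1, hm2, hm3⟩ := (mem_upperHalf hN).mp hm1
    refine ⟨n, Finset.mem_filter.mpr ⟨Finset.mem_Icc.mpr ⟨Nat.pos_of_mul_pos_left hm1,
      Nat.le_floor (le_trans ?_ hm2)⟩, hm3, hm2⟩, rfl⟩
    exact_mod_cast Nat.le_mul_of_pos_left n h1
  · intro n hn
    have hhh : (h : ℂ) ^ (-(τ : ℂ) * Complex.I) * (h : ℂ) ^ ((τ : ℂ) * Complex.I) = 1 := by
      rw [← Complex.cpow_add _ _ (by exact_mod_cast h0.ne')]
      simp
    rw [Nat.cast_mul, Nat.cast_mul, Complex.natCast_mul_natCast_cpow, Real.sqrt_mul h0.le, mul_inv]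
    have hs : (h : ℝ)⁻¹ = (√h)⁻¹ * (√h)⁻¹ := by rw [← mul_inv, Real.mul_self_sqrt h0.le]
    rw [hs]
    push_cast
    linear_combination (-((√(h : ℝ) : ℂ)⁻¹ * (√(h : ℝ) : ℂ)⁻¹ * (√(n : ℝ) : ℂ)⁻¹ *
      (n : ℂ) ^ ((τ : ℂ) * Complex.I))) * hhh

-- After expansion all terms are nonnegative, and a pair (m, n) is counted once for each common
-- divisor h in H, hence at most D times.
open Classical in
lemma sum_meanSquare_dvd_le {ι : Type*} (I : Finset ι) (x : ι → ℝ) (H J : Finset ℕ) (hJ : 0 ∉ J)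
    {b : ℕ → ℝ} (hb : ∀ n ∈ J, 0 ≤ b n) {D : ℝ}
    (hD : ∀ n ∈ J, (n.divisors.card : ℝ) ≤ D) :
    ∑ h ∈ H, meanSquare I x J (fun m => ((if h ∣ m then b m else 0 : ℝ) : ℂ)) ≤
      D * meanSquare I x J (fun m => (b m : ℂ)) := by
  rw [meanSquare_ofReal I x hJ]
  have h1 : ∀ h ∈ H, meanSquare I x J (fun m => ((if h ∣ m then b m else 0 : ℝ) : ℂ)) =
      ∑ m ∈ J, ∑ n ∈ J, (if h ∣ m then b m else 0) * (if h ∣ n then b n else 0) *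
        ratioKernel I x m n := fun h _ =>
    meanSquare_ofReal I x hJ (fun m => if h ∣ m then b m else 0)
  rw [Finset.sum_congr rfl h1, Finset.sum_comm, Finset.mul_sum]
  refine Finset.sum_le_sum fun m hm => ?_
  rw [Finset.sum_comm, Finset.mul_sum]
  refine Finset.sum_le_sum fun n hn => ?_
  have hbb : 0 ≤ b m * b n * ratioKernel I x m n :=
    mul_nonneg (mul_nonneg (hb m hm) (hb n hn)) (ratioKernel_nonneg ..)
  have hm0 : m ≠ 0 := fun h => hJ (h ▸ hm)
  calc _ ≤ ∑ h ∈ H, if h ∣ m then b m * b n * ratioKernel I x m n else 0 := by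
        refine Finset.sum_le_sum fun h _ => ?_
        by_cases h1 : h ∣ m <;> by_cases h2 : h ∣ n <;> simp [h1, h2, hbb]
    _ = ((H.filter fun h => h ∣ m).card : ℝ) * (b m * b n * ratioKernel I x m n) := by
        rw [← Finset.sum_filter, Finset.sum_const, nsmul_eq_mul]
    _ ≤ D * (b m * b n * ratioKernel I x m n) := by
        gcongr
        refine le_trans ?_ (hD m hm)
        exact_mod_cast Finset.card_le_card fun h hh =>
          Nat.mem_divisors.mpr ⟨(Finset.mem_filter.mp hh).2, hm0⟩

/-- The full range `[1, N]` is controlled by its upper half. -/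
lemma zetaMeanSquare_le_upperHalf {ι : Type*} (I : Finset ι) (x : ι → ℝ) {N D : ℝ} (hN : 1 ≤ N)
    (hD : ∀ n : ℕ, n ≠ 0 → (n : ℝ) ≤ N → (n.divisors.card : ℝ) ≤ D) :
    zetaMeanSquare I x N ≤ 16 * (1 + Real.log N) * D *
      meanSquare I x (upperHalf N) (fun n => (((√n)⁻¹ : ℝ) : ℂ)) := by
  classical
  have hN0 : 0 ≤ N := by linarith
  set J := Finset.Icc 1 ⌊N⌋₊
  set V := meanSquare I x (upperHalf N) (fun n => (((√n)⁻¹ : ℝ) : ℂ)) with hV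
  set c : ℕ → ℝ := fun n => ∑ h ∈ J.filter
      (fun h => N / 2 < (h * n : ℕ) ∧ ((h * n : ℕ) : ℝ) ≤ N), (h : ℝ)⁻¹ with hc
  have hc4 : ∀ n ∈ J, 1 / 4 ≤ c n := fun n hn =>
    quarter_le_sum_inv (Finset.mem_Icc.mp hn).1
      ((Nat.le_floor_iff hN0).mp (Finset.mem_Icc.mp hn).2)
  -- The majorant principle with coefficients 4 c(n) n^(-1/2) ≥ n^(-1/2); the factor 16 is 4².
  have h1 : zetaMeanSquare I x N ≤ 16 * meanSquare I x J (fun n => ((c n * (√n)⁻¹ : ℝ) : ℂ)) := by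
    have e : (16 : ℝ) = ‖(4 : ℂ)‖ ^ 2 := by norm_num
    rw [e, ← meanSquare_const_mul]
    have e2 : (fun n : ℕ => (4 : ℂ) * ((c n * (√n)⁻¹ : ℝ) : ℂ)) =
        fun n : ℕ => ((4 * (c n * (√n)⁻¹) : ℝ) : ℂ) := by ext n; push_cast; ring
    rw [e2]
    refine meanSquare_le_of_norm_le I x (Finset.Subset.refl _) (by simp) (fun n hn => ?_)
      (fun n hn => ?_)
    · rw [Complex.norm_real, Real.norm_of_nonneg (by positivity)]
      have := hc4 n hn
      have h0 : 0 ≤ (√(n : ℝ))⁻¹ := by positivity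
      nlinarith
    · have := hc4 n hn
      have h0 : 0 ≤ (√(n : ℝ))⁻¹ := by positivity
      positivity
  -- Cauchy-Schwarz in h; the factor h^(-iτ) has modulus 1, so the weights are h^(-1/2), with
  -- squares summing to at most 1 + log N.
  have h2 : meanSquare I x J (fun n => ((c n * (√n)⁻¹ : ℝ) : ℂ)) ≤ (∑ h ∈ J, (h : ℝ)⁻¹) *
      ∑ h ∈ J, meanSquare I x (upperHalf N)
        (fun m => ((if h ∣ m then (√m)⁻¹ else 0 : ℝ) : ℂ)) := by
    have hpt : ∀ τ : ℝ, ‖∑ n ∈ J, ((c n * (√n)⁻¹ : ℝ) : ℂ) * (n : ℂ) ^ ((τ : ℂ) * Complex.I)‖ ^ 2 ≤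
        (∑ h ∈ J, (h : ℝ)⁻¹) * ∑ h ∈ J, ‖∑ m ∈ upperHalf N,
          ((if h ∣ m then (√m)⁻¹ else 0 : ℝ) : ℂ) * (m : ℂ) ^ ((τ : ℂ) * Complex.I)‖ ^ 2 := by
      intro τ
      rw [sum_dvd_rearrange hN0 τ]
      have hn : ∀ h ∈ J, ‖(((√(h : ℝ))⁻¹ : ℝ) : ℂ) * (h : ℂ) ^ (-(τ : ℂ) * Complex.I)‖ =
          (√(h : ℝ))⁻¹ := by
        intro h hh
        have h0 : 0 < h := (Finset.mem_Icc.mp hh).1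
        rw [norm_mul, Complex.norm_real, Real.norm_of_nonneg (by positivity),
          Complex.norm_natCast_cpow_of_pos h0]
        simp
      have hsq : ∀ h ∈ J, (h : ℝ)⁻¹ = ((√(h : ℝ))⁻¹) ^ 2 := by
        intro h _
        rw [inv_pow, Real.sq_sqrt (by positivity)]
      rw [Finset.sum_congr rfl hsq]
      refine le_trans ?_ (Finset.sum_mul_sq_le_sq_mul_sq ..)
      gcongr
      refine (norm_sum_le _ _).trans (le_of_eq (Finset.sum_congr rfl fun h hh => ?_))
      rw [norm_mul, hn h hh]
    unfold meanSquare
    refine (Finset.sum_le_sum fun u _ => Finset.sum_le_sum fun v _ => hpt (x u - x v)).trans ?_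
    rw [Finset.sum_comm (s := J)]
    simp_rw [Finset.sum_comm (s := J), Finset.mul_sum]
    exact le_rfl
  have h3 := sum_meanSquare_dvd_le I x J (upperHalf N) (by simp [upperHalf])
    (b := fun m => (√m)⁻¹) (fun n _ => by positivity) (D := D) (fun n hn => by
      obtain ⟨a1, a2, a3⟩ := (mem_upperHalf hN0).mp hn
      exact hD n (by omega) a2)
  have h4 : ∑ h ∈ J, (h : ℝ)⁻¹ ≤ 1 + Real.log N := by
    have := harmonic_floor_le_one_add_log N hN
    rw [harmonic_eq_sum_Icc] at this
    push_cast at this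
    exact this
  have hlog : 0 ≤ Real.log N := Real.log_nonneg hN
  calc zetaMeanSquare I x N ≤ _ := h1
    _ ≤ 16 * ((1 + Real.log N) * (D * V)) := by
        have hs : 0 ≤ ∑ h ∈ J, meanSquare I x (upperHalf N)
          (fun m => ((if h ∣ m then (√m)⁻¹ else 0 : ℝ) : ℂ)) :=
          Finset.sum_nonneg fun h _ => meanSquare_nonneg ..
        refine mul_le_mul_of_nonneg_left (h2.trans ?_) (by norm_num)
        exact mul_le_mul h4 h3 hs (by linarith)
    _ = _ := by ring

/-! ### The log-normal weight as a superposition of powers. -/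

/-- The function `exp (-log² (y / N)) y ^ (-1/2 + iτ)` on the positive reals, extended by zero. -/
noncomputable def logNormal (N τ y : ℝ) : ℂ :=
  if 0 < y then (Real.exp (-(Real.log (y / N)) ^ 2) : ℂ) *
    (y : ℂ) ^ (-1 / 2 + (τ : ℂ) * Complex.I) else 0

lemma norm_logNormal {N τ y : ℝ} (hy : 0 < y) :
    ‖logNormal N τ y‖ = Real.exp (-(Real.log (y / N)) ^ 2) * y ^ (-1 / 2 : ℝ) := by
  rw [logNormal, if_pos hy, norm_mul, Complex.norm_real, Real.norm_of_nonneg (Real.exp_pos _).le,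
    Complex.norm_cpow_eq_rpow_re_of_pos hy]
  norm_num

/-- Completing the square: -X² ≤ a²/4 - aX with X = log(y/N). The free exponent a yields decay of
any power order at 0 and at infinity. -/
lemma norm_logNormal_le {N τ y : ℝ} (hN : 0 < N) (hy : 0 < y) (a : ℝ) :
    ‖logNormal N τ y‖ ≤ Real.exp (a ^ 2 / 4) * N ^ a * y ^ (-1 / 2 - a) := by
  rw [norm_logNormal hy]
  have h1 : Real.exp (-(Real.log (y / N)) ^ 2) ≤
      Real.exp (a ^ 2 / 4) * (N ^ a * y ^ (-a)) := by
    rw [Real.rpow_def_of_pos hN, Real.rpow_def_of_pos hy, ← Real.exp_add, ← Real.exp_add,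
      Real.log_div hy.ne' hN.ne']
    refine Real.exp_le_exp.mpr ?_
    nlinarith [sq_nonneg (Real.log y - Real.log N - a / 2)]
  calc _ ≤ Real.exp (a ^ 2 / 4) * (N ^ a * y ^ (-a)) * y ^ (-1 / 2 : ℝ) := by gcongr
    _ = _ := by rw [sub_eq_add_neg, Real.rpow_add hy]; ring

lemma continuous_logNormal {N : ℝ} (hN : 0 < N) (τ : ℝ) : Continuous (logNormal N τ) := by
  rw [continuous_iff_continuousAt]
  intro y
  rcases lt_trichotomy y 0 with hy | hy | hy
  · refine (continuousAt_const (y := (0 : ℂ))).congr ?_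
    filter_upwards [Iio_mem_nhds hy] with z hz
    rw [logNormal, if_neg (not_lt.mpr (le_of_lt hz))]
  · subst hy
    have h0 : logNormal N τ 0 = 0 := by simp [logNormal]
    rw [ContinuousAt, h0]
    -- The exponent a = -3/2 makes the bound linear in z, so the function tends to 0 at the origin.
    have hb : ∀ z, ‖logNormal N τ z‖ ≤ Real.exp ((-3 / 2) ^ 2 / 4) * N ^ (-3 / 2 : ℝ) * |z| := by
      intro z
      rcases lt_or_ge 0 z with hz | hz
      · have := norm_logNormal_le (τ := τ) hN hz (-3 / 2)
        norm_num at this ⊢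
        rwa [abs_of_pos hz]
      · rw [logNormal, if_neg (not_lt.mpr hz), norm_zero]; positivity
    refine squeeze_zero_norm hb ?_
    have : Continuous fun z : ℝ => Real.exp ((-3 / 2) ^ 2 / 4) * N ^ (-3 / 2 : ℝ) * |z| := by
      fun_prop
    simpa using this.tendsto 0
  · have : ContinuousAt (fun y : ℝ => (Real.exp (-(Real.log (y / N)) ^ 2) : ℂ) *
        (y : ℂ) ^ (-1 / 2 + (τ : ℂ) * Complex.I)) y := by
      have h1 : ContinuousAt (fun y : ℝ => Real.log (y / N)) y :=
        ContinuousAt.log (by fun_prop) (by positivity)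
      have h2 : ContinuousAt (fun y : ℝ => (y : ℂ) ^ (-1 / 2 + (τ : ℂ) * Complex.I)) y :=
        Complex.continuousAt_ofReal_cpow_const _ _ (Or.inr hy.ne')
      refine ContinuousAt.mul ?_ h2
      exact Complex.continuous_ofReal.continuousAt.comp (h1.pow 2).neg.rexp
    refine this.congr ?_
    filter_upwards [Ioi_mem_nhds hy] with z hz
    rw [logNormal, if_pos (show 0 < z from hz)]

lemma exists_norm_logNormal_le {N : ℝ} (hN : 0 < N) (τ : ℝ) :
    ∃ C : ℝ, 0 < C ∧ ∀ y, ‖logNormal N τ y‖ ≤ C * (1 + y ^ 2)⁻¹ := by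
  set C₁ := Real.exp ((-1 / 2) ^ 2 / 4) * N ^ (-1 / 2 : ℝ)
  set C₂ := Real.exp ((3 / 2) ^ 2 / 4) * N ^ (3 / 2 : ℝ)
  refine ⟨C₁ + C₂, by positivity, fun y => ?_⟩
  rcases lt_or_ge 0 y with hy | hy
  · have h1 := norm_logNormal_le (τ := τ) hN hy (-1 / 2)
    have h2 := norm_logNormal_le (τ := τ) hN hy (3 / 2)
    have e1 : (-1 / 2 - -1 / 2 : ℝ) = 0 := by norm_num
    have e2 : (-1 / 2 - 3 / 2 : ℝ) = -2 := by norm_num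
    rw [e1, Real.rpow_zero, mul_one] at h1
    rw [e2, Real.rpow_neg hy.le, Real.rpow_two] at h2
    rw [← div_eq_mul_inv, le_div_iff₀ (by positivity), mul_add, mul_one]
    refine add_le_add h1 ?_
    rwa [← div_eq_mul_inv, le_div_iff₀ (by positivity)] at h2
  · rw [logNormal, if_neg (not_lt.mpr hy), norm_zero]; positivity

lemma integrable_logNormal {N : ℝ} (hN : 0 < N) (τ : ℝ) :
    MeasureTheory.Integrable (logNormal N τ) := by
  obtain ⟨C, _, hC⟩ := exists_norm_logNormal_le hN τ
  exact (integrable_inv_one_add_sq.const_mul C).mono'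
    (continuous_logNormal hN τ).aestronglyMeasurable (Filter.Eventually.of_forall hC)

/-- The Gaussian integral that expresses `logNormal` as a superposition of powers. -/
lemma integral_cexp_line (c τ Y : ℝ) :
    ∫ v : ℝ, Complex.exp (((c : ℂ) + (τ - v) * Complex.I) ^ 2 / 4 -
      Y * ((c : ℂ) + (τ - v) * Complex.I)) = (2 * √Real.pi : ℝ) * Real.exp (-Y ^ 2) := by
  have h := integral_cexp_quadratic (b := -1 / 4) (by norm_num)
    (-Complex.I * (c + τ * Complex.I) / 2 + Complex.I * Y)
    ((c + τ * Complex.I) ^ 2 / 4 - Y * (c + τ * Complex.I))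
  have e1 : ∀ v : ℝ, ((c : ℂ) + (τ - v) * Complex.I) ^ 2 / 4 -
      Y * ((c : ℂ) + (τ - v) * Complex.I) = -1 / 4 * (v : ℂ) ^ 2 +
      (-Complex.I * (c + τ * Complex.I) / 2 + Complex.I * Y) * v +
      ((c + τ * Complex.I) ^ 2 / 4 - Y * (c + τ * Complex.I)) := by
    intro v
    linear_combination ((v : ℂ) ^ 2 / 4) * Complex.I_sq
  simp_rw [e1, h]
  congr 1
  · have : ((Real.pi : ℂ) / -(-1 / 4)) = ((4 * Real.pi : ℝ) : ℂ) := by push_cast; ring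
    rw [this, show (1 / 2 : ℂ) = ((1 / 2 : ℝ) : ℂ) by push_cast; rfl,
      ← Complex.ofReal_cpow (by positivity), ← Real.sqrt_eq_rpow]
    rw [Real.sqrt_mul (by norm_num), show (4 : ℝ) = 2 ^ 2 by norm_num,
      Real.sqrt_sq (by norm_num)]
  · rw [Complex.ofReal_exp]
    congr 1
    push_cast
    linear_combination (((Y : ℂ) - (c + τ * Complex.I) / 2) ^ 2) * Complex.I_sq

lemma norm_cexp_line (c t : ℝ) :
    ‖Complex.exp (((c : ℂ) + (t : ℂ) * Complex.I) ^ 2 / 4)‖ =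
      Real.exp (c ^ 2 / 4) * Real.exp (-(1 / 4) * t ^ 2) := by
  rw [Complex.norm_exp, ← Real.exp_add]
  congr 1
  have : ((c : ℂ) + (t : ℂ) * Complex.I) ^ 2 / 4 =
      (((c ^ 2 - t ^ 2) / 4 : ℝ) : ℂ) + ((c * t / 2 : ℝ) : ℂ) * Complex.I := by
    push_cast
    linear_combination ((t : ℂ) ^ 2 / 4) * Complex.I_sq
  rw [this]
  simp only [Complex.add_re, Complex.ofReal_re, Complex.mul_re, Complex.I_re, mul_zero,
    Complex.ofReal_im, Complex.I_im, mul_one, sub_self, add_zero]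
  ring

lemma integrable_gaussian_sub (τ : ℝ) :
    MeasureTheory.Integrable fun v : ℝ => Real.exp (-(1 / 4) * (τ - v) ^ 2) :=
  (integrable_exp_neg_mul_sq (b := 1 / 4) (by norm_num)).comp_sub_left τ

/-- Mellin inversion on the line Re s = -j, where s = -j + i(τ - v). The Mellin transform exp(s²/4)
N^s is entire with Gaussian decay, so every j is allowed, and each unit of j gains a factor 1/N. The
variable v is chosen so that the power of y does not involve τ. -/
lemma logNormal_eq_integral {N y : ℝ} (hN : 0 < N) (hy : 0 < y) (τ : ℝ) (j : ℕ) :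
    logNormal N τ y = ((2 * √Real.pi : ℝ) : ℂ)⁻¹ * ∫ v : ℝ,
      Complex.exp ((((-(j : ℝ) : ℝ) : ℂ) + ((τ - v : ℝ) : ℂ) * Complex.I) ^ 2 / 4) *
        (N : ℂ) ^ (((-(j : ℝ) : ℝ) : ℂ) + ((τ - v : ℝ) : ℂ) * Complex.I) *
        (y : ℂ) ^ ((1 / 2 + j : ℂ) + (v : ℂ) * Complex.I - 1) := by
  have hyc : (y : ℂ) ≠ 0 := by exact_mod_cast hy.ne'
  have hNc : (N : ℂ) ≠ 0 := by exact_mod_cast hN.ne'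
  have h := integral_cexp_line (-(j : ℝ)) τ (Real.log (y / N))
  rw [logNormal, if_pos hy]
  have e : ∀ v : ℝ, Complex.exp ((((-(j : ℝ) : ℝ) : ℂ) + ((τ - v : ℝ) : ℂ) * Complex.I) ^ 2 / 4) *
        (N : ℂ) ^ (((-(j : ℝ) : ℝ) : ℂ) + ((τ - v : ℝ) : ℂ) * Complex.I) *
        (y : ℂ) ^ ((1 / 2 + j : ℂ) + (v : ℂ) * Complex.I - 1) =
      (y : ℂ) ^ (-1 / 2 + (τ : ℂ) * Complex.I) *
      Complex.exp ((((-(j : ℝ) : ℝ) : ℂ) + (τ - v) * Complex.I) ^ 2 / 4 -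
      (Real.log (y / N) : ℝ) * (((-(j : ℝ) : ℝ) : ℂ) + (τ - v) * Complex.I)) := by
    intro v
    rw [Complex.cpow_def_of_ne_zero hyc, Complex.cpow_def_of_ne_zero hyc,
      Complex.cpow_def_of_ne_zero hNc, ← Complex.exp_add, ← Complex.exp_add, ← Complex.exp_add,
      Real.log_div hy.ne' hN.ne', ← Complex.ofReal_log hy.le, ← Complex.ofReal_log hN.le]
    congr 1
    push_cast
    ring
  simp_rw [e]
  rw [MeasureTheory.integral_const_mul, h]
  have : ((2 * √Real.pi : ℝ) : ℂ) ≠ 0 := by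
    have : 0 < √Real.pi := Real.sqrt_pos.mpr Real.pi_pos
    exact_mod_cast (by positivity)
  field_simp

/-! ### Laplace transform of the weight and decay of the Gamma function. -/

/-- The Laplace transform of a power on the right half-plane. -/
lemma integral_cpow_mul_cexp_neg_mul_Ioi {a w : ℂ} (ha : 0 < a.re) (hw : 0 < w.re) :
    ∫ y in Set.Ioi (0 : ℝ), (y : ℂ) ^ (a - 1) * Complex.exp (-(w * y)) =
      (1 / w) ^ a * Complex.Gamma a := by
  set U : Set ℂ := {z | 0 < z.re} with hU
  have hUo : IsOpen U := isOpen_lt continuous_const Complex.continuous_re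
  have hbd : ∀ s r : ℝ, -1 < s → 0 < r → MeasureTheory.Integrable
      (fun y : ℝ => y ^ s * Real.exp (-(r * y)))
      (MeasureTheory.volume.restrict (Set.Ioi (0 : ℝ))) := by
    intro s r hs hr
    have := integrableOn_rpow_mul_exp_neg_mul_rpow hs one_pos hr
    simp only [Real.rpow_one, neg_mul] at this
    exact this
  have hdF : DifferentiableOn ℂ (fun z : ℂ => ∫ y in Set.Ioi (0 : ℝ),
      (y : ℂ) ^ (a - 1) * Complex.exp (-(z * y))) U := by
    intro z hz
    have hz' : 0 < z.re := hz
    refine DifferentiableAt.differentiableWithinAt ?_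
    refine (hasDerivAt_integral_of_dominated_loc_of_deriv_le
      (F' := fun z y => (y : ℂ) ^ (a - 1) * (Complex.exp (-(z * y)) * (-y)))
      (bound := fun y => y ^ a.re * Real.exp (-(z.re / 2 * y)))
      (Metric.ball_mem_nhds z (half_pos hz')) ?_ ?_ ?_ ?_ ?_ ?_).2.differentiableAt
    · exact Filter.Eventually.of_forall fun w => by fun_prop
    · refine (hbd (a.re - 1) z.re (by linarith) hz').mono' (by fun_prop) ?_
      filter_upwards [MeasureTheory.ae_restrict_mem measurableSet_Ioi] with y hy
      rw [norm_mul, Complex.norm_cpow_eq_rpow_re_of_pos hy, Complex.norm_exp]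
      simp
    · fun_prop
    · filter_upwards [MeasureTheory.ae_restrict_mem measurableSet_Ioi] with y hy w hw
      have hy0 : (0 : ℝ) < y := hy
      have hwz : z.re / 2 ≤ w.re := by
        have h1 : |(w - z).re| ≤ ‖w - z‖ := Complex.abs_re_le_norm _
        have h2 : ‖w - z‖ < z.re / 2 := by simpa [dist_eq_norm] using hw
        have h3 := (abs_le.mp h1).1
        simp only [Complex.sub_re] at h3
        linarith
      rw [norm_mul, norm_mul, Complex.norm_cpow_eq_rpow_re_of_pos hy0, Complex.norm_exp, norm_neg,
        Complex.norm_real, Real.norm_of_nonneg hy0.le]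
      have e1 : (-(w * (y : ℂ))).re = -(w.re * y) := by simp
      have e2 : (a - 1).re = a.re - 1 := by simp
      have e3 : y ^ a.re = y ^ (a.re - 1) * y := by
        rw [← Real.rpow_add_one hy0.ne']; congr 1; ring
      rw [e1, e2, e3]
      have : Real.exp (-(w.re * y)) ≤ Real.exp (-(z.re / 2 * y)) :=
        Real.exp_le_exp.mpr (by nlinarith)
      calc y ^ (a.re - 1) * (Real.exp (-(w.re * y)) * y)
          ≤ y ^ (a.re - 1) * (Real.exp (-(z.re / 2 * y)) * y) := by gcongr
        _ = _ := by ring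
    · exact hbd a.re (z.re / 2) (by linarith) (half_pos hz')
    · refine Filter.Eventually.of_forall fun y w _ => ?_
      have h1 : HasDerivAt (fun w : ℂ => -(w * y)) (-(y : ℂ)) w := by
        have h := ((hasDerivAt_id w).mul_const (y : ℂ)).neg
        rw [one_mul] at h
        exact h
      exact (h1.cexp).const_mul _
  have hdG : DifferentiableOn ℂ (fun z : ℂ => (1 / z) ^ a * Complex.Gamma a) U := by
    intro z hz
    have hz' : 0 < z.re := hz
    have hz0 : z ≠ 0 := fun h => by simp [h] at hz'
    refine DifferentiableAt.differentiableWithinAt ?_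
    refine DifferentiableAt.mul_const ?_ _
    refine DifferentiableAt.cpow (by fun_prop (disch := exact hz0)) (by fun_prop) ?_
    refine Or.inl ?_
    rw [one_div, Complex.inv_re]
    exact div_pos hz' (Complex.normSq_pos.mpr hz0)
  have hconv : IsPreconnected U := (convex_halfSpace_re_gt 0).isPreconnected
  -- Both sides are holomorphic in w on the half-plane, so agreement at the real points 1 + 1/(n+1),
  -- which accumulate at 1, is enough.
  refine (hdF.analyticOnNhd hUo).eqOn_of_preconnected_of_frequently_eq (hdG.analyticOnNhd hUo)
    hconv (z₀ := 1) (by simp [hU]) ?_ hw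
  have ht : Filter.Tendsto (fun n : ℕ => ((1 + 1 / ((n : ℝ) + 1) : ℝ) : ℂ)) Filter.atTop
      (nhdsWithin 1 {1}ᶜ) := by
    refine tendsto_nhdsWithin_iff.mpr ⟨?_, Filter.Eventually.of_forall fun n => ?_⟩
    · have h := (tendsto_one_div_add_atTop_nhds_zero_nat (𝕜 := ℝ)).const_add 1
      have h2 : Filter.Tendsto (fun n : ℕ => ((1 + 1 / ((n : ℝ) + 1) : ℝ) : ℂ)) Filter.atTop
          (nhds ((1 + 0 : ℝ) : ℂ)) := (Complex.continuous_ofReal.tendsto _).comp h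
      rwa [add_zero, Complex.ofReal_one] at h2
    · simp only [Set.mem_compl_iff, Set.mem_singleton_iff]
      have : (0 : ℝ) < 1 / ((n : ℝ) + 1) := by positivity
      intro h
      have h' : (1 + 1 / ((n : ℝ) + 1) : ℝ) = 1 := by exact_mod_cast h
      linarith
  refine ht.frequently (Filter.Frequently.of_forall fun n => ?_)
  exact Complex.integral_cpow_mul_exp_neg_mul_Ioi ha (by positivity)

lemma laplace_logNormal {N : ℝ} (hN : 0 < N) (τ : ℝ) (j : ℕ) {w : ℂ} (hw : 0 < w.re) :
    ∫ y in Set.Ioi (0 : ℝ), logNormal N τ y * Complex.exp (-(w * y)) =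
      ((2 * √Real.pi : ℝ) : ℂ)⁻¹ * ∫ v : ℝ,
      Complex.exp ((((-(j : ℝ) : ℝ) : ℂ) + ((τ - v : ℝ) : ℂ) * Complex.I) ^ 2 / 4) *
        (N : ℂ) ^ (((-(j : ℝ) : ℝ) : ℂ) + ((τ - v : ℝ) : ℂ) * Complex.I) *
        ((1 / w) ^ ((1 / 2 + j : ℂ) + (v : ℂ) * Complex.I) *
          Complex.Gamma ((1 / 2 + j : ℂ) + (v : ℂ) * Complex.I)) := by
  set A : ℝ → ℂ := fun v =>
    Complex.exp ((((-(j : ℝ) : ℝ) : ℂ) + ((τ - v : ℝ) : ℂ) * Complex.I) ^ 2 / 4) *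
        (N : ℂ) ^ (((-(j : ℝ) : ℝ) : ℂ) + ((τ - v : ℝ) : ℂ) * Complex.I) with hA
  have hAn : ∀ v, ‖A v‖ =
      Real.exp ((-(j : ℝ)) ^ 2 / 4) * N ^ (-(j : ℝ)) * Real.exp (-(1 / 4) * (τ - v) ^ 2) := by
    intro v
    rw [hA, norm_mul, norm_cexp_line, Complex.norm_cpow_eq_rpow_re_of_pos hN]
    simp only [Complex.add_re, Complex.ofReal_re, Complex.mul_re, Complex.I_re, mul_zero,
      Complex.ofReal_im, Complex.I_im, mul_one, sub_self, add_zero]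
    ring
  have hAm : Measurable A := by
    rw [hA]; fun_prop
  have h1 : ∀ y ∈ Set.Ioi (0 : ℝ), logNormal N τ y * Complex.exp (-(w * y)) =
      ((2 * √Real.pi : ℝ) : ℂ)⁻¹ * ∫ v : ℝ, A v *
        ((y : ℂ) ^ ((1 / 2 + j : ℂ) + (v : ℂ) * Complex.I - 1) * Complex.exp (-(w * y))) := by
    intro y hy
    rw [logNormal_eq_integral hN hy τ j, mul_assoc, ← MeasureTheory.integral_mul_const]
    simp_rw [hA, mul_assoc]
  rw [MeasureTheory.setIntegral_congr_fun measurableSet_Ioi h1, MeasureTheory.integral_const_mul]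
  congr 1
  rw [MeasureTheory.integral_integral_swap]
  · refine MeasureTheory.integral_congr_ae (Filter.Eventually.of_forall fun v => ?_)
    simp only
    rw [MeasureTheory.integral_const_mul, integral_cpow_mul_cexp_neg_mul_Ioi _ hw]
    simp
    positivity
  · have hg1 : MeasureTheory.Integrable (fun y : ℝ => y ^ ((j : ℝ) - 1 / 2) *
        Real.exp (-w.re * y)) (MeasureTheory.volume.restrict (Set.Ioi 0)) := by
      have := integrableOn_rpow_mul_exp_neg_mul_rpow (s := (j : ℝ) - 1 / 2) (p := 1) (b := w.re)
        (by have : (0 : ℝ) ≤ j := by positivity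
            linarith) one_pos hw
      simp only [Real.rpow_one] at this
      exact this
    have hg2 := (integrable_gaussian_sub τ).const_mul
      (Real.exp ((-(j : ℝ)) ^ 2 / 4) * N ^ (-(j : ℝ)))
    refine (hg1.mul_prod hg2).mono' ?_ ?_
    · refine Measurable.aestronglyMeasurable ?_
      simp only [Function.uncurry_def]
      refine (hAm.comp measurable_snd).mul ?_
      fun_prop
    · have : ∀ᵐ p : ℝ × ℝ ∂((MeasureTheory.volume.restrict (Set.Ioi (0 : ℝ))).prod
          MeasureTheory.volume), 0 < p.1 := by
        have h0 : ∀ᵐ y : ℝ ∂(MeasureTheory.volume.restrict (Set.Ioi (0 : ℝ))), 0 < y :=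
          MeasureTheory.ae_restrict_mem measurableSet_Ioi
        exact MeasureTheory.Measure.quasiMeasurePreserving_fst.ae h0
      filter_upwards [this] with p hp
      simp only [Function.uncurry_def]
      rw [norm_mul (A p.2), hAn, norm_mul, Complex.norm_cpow_eq_rpow_re_of_pos hp, Complex.norm_exp]
      have e1 : ((1 / 2 + j : ℂ) + (p.2 : ℂ) * Complex.I - 1).re = (j : ℝ) - 1 / 2 := by
        simp; ring
      have e2 : (-(w * (p.1 : ℂ))).re = -w.re * p.1 := by simp
      rw [e1, e2, mul_comm]

/-- The reflection formula gives |Γ(1/2 + iv)|² = π / cosh(πv). -/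
lemma norm_Gamma_half_line (v : ℝ) :
    ‖Complex.Gamma (1 / 2 + (v : ℂ) * Complex.I)‖ * Real.exp (Real.pi / 2 * |v|) ≤
      √(2 * Real.pi) := by
  have h1 := Complex.Gamma_mul_Gamma_one_sub (1 / 2 + (v : ℂ) * Complex.I)
  have h2 : (1 - (1 / 2 + (v : ℂ) * Complex.I)) = (starRingEnd ℂ) (1 / 2 + (v : ℂ) * Complex.I) := by
    simp only [map_add, map_div₀, map_one, map_ofNat, map_mul, Complex.conj_ofReal, Complex.conj_I]
    ring
  rw [h2, Complex.Gamma_conj, Complex.mul_conj'] at h1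
  have h3 : Complex.sin (Real.pi * (1 / 2 + (v : ℂ) * Complex.I)) =
      (Real.cosh (Real.pi * v) : ℂ) := by
    rw [mul_add, ← mul_assoc, show (Real.pi : ℂ) * (1 / 2) = Real.pi / 2 by ring, add_comm,
      Complex.sin_add_pi_div_two, Complex.cos_mul_I]
    push_cast; rfl
  rw [h3] at h1
  have h4 : ‖Complex.Gamma (1 / 2 + (v : ℂ) * Complex.I)‖ ^ 2 = Real.pi / Real.cosh (Real.pi * v) := by
    exact_mod_cast h1
  have h5 : Real.exp (Real.pi * |v|) ≤ 2 * Real.cosh (Real.pi * v) := by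
    rw [← Real.cosh_abs, abs_mul, abs_of_pos Real.pi_pos, Real.cosh_eq]
    have := Real.exp_pos (-(Real.pi * |v|))
    linarith
  refine Real.le_sqrt_of_sq_le ?_
  rw [mul_pow, h4, ← Real.exp_nat_mul]
  have h6 : ((2 : ℕ) : ℝ) * (Real.pi / 2 * |v|) = Real.pi * |v| := by push_cast; ring
  rw [h6, div_mul_eq_mul_div, div_le_iff₀ (Real.cosh_pos _)]
  nlinarith [Real.pi_pos]

/-- The functional equation Γ(s + 1) = sΓ(s) is applied j times from the line Re s = 1/2; each
factor s has modulus at most (j + 1)(1 + |v|). -/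
lemma norm_Gamma_shifted_line (j : ℕ) (v : ℝ) :
    ‖Complex.Gamma ((1 / 2 + j : ℂ) + (v : ℂ) * Complex.I)‖ * Real.exp (Real.pi / 2 * |v|) ≤
      √(2 * Real.pi) * (j + 1) ^ j * (1 + |v|) ^ j := by
  have key : ∀ i : ℕ, i ≤ j → ‖Complex.Gamma ((1 / 2 + i : ℂ) + (v : ℂ) * Complex.I)‖ *
      Real.exp (Real.pi / 2 * |v|) ≤ √(2 * Real.pi) * ((j + 1) * (1 + |v|)) ^ i := by
    intro i
    induction i with
    | zero => intro _; simpa using norm_Gamma_half_line v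
    | succ i ih =>
      intro hi
      have h1 := ih (by omega)
      have hre : ((1 / 2 + i : ℂ) + (v : ℂ) * Complex.I).re = 1 / 2 + i := by simp
      have hne : ((1 / 2 + i : ℂ) + (v : ℂ) * Complex.I) ≠ 0 := by
        intro h
        rw [h] at hre
        simp only [Complex.zero_re] at hre
        have : (0 : ℝ) ≤ i := by positivity
        linarith
      have h2 : ((1 / 2 + (i + 1 : ℕ) : ℂ) + (v : ℂ) * Complex.I) =
          ((1 / 2 + i : ℂ) + (v : ℂ) * Complex.I) + 1 := by push_cast; ring
      rw [h2, Complex.Gamma_add_one _ hne, norm_mul, pow_succ]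
      have h3 : ‖(1 / 2 + i : ℂ) + (v : ℂ) * Complex.I‖ ≤ (j + 1) * (1 + |v|) := by
        have hij : (i : ℝ) + 1 ≤ j := by exact_mod_cast hi
        calc _ ≤ ‖(1 / 2 + i : ℂ)‖ + ‖(v : ℂ) * Complex.I‖ := norm_add_le _ _
          _ = (1 / 2 + i) + |v| := by
              rw [norm_mul, Complex.norm_I, mul_one, Complex.norm_real, Real.norm_eq_abs]
              congr 1
              have : (1 / 2 + i : ℂ) = ((1 / 2 + i : ℝ) : ℂ) := by push_cast; rfl
              rw [this, Complex.norm_real, Real.norm_of_nonneg (by positivity)]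
          _ ≤ _ := by nlinarith [abs_nonneg v, mul_nonneg (Nat.cast_nonneg (α := ℝ) j) (abs_nonneg v)]
      calc _ = ‖(1 / 2 + i : ℂ) + (v : ℂ) * Complex.I‖ *
            (‖Complex.Gamma ((1 / 2 + i : ℂ) + (v : ℂ) * Complex.I)‖ *
              Real.exp (Real.pi / 2 * |v|)) := by ring
        _ ≤ ((j + 1) * (1 + |v|)) * (√(2 * Real.pi) * ((j + 1) * (1 + |v|)) ^ i) := by gcongr
        _ = _ := by ring
  have := key j le_rfl
  rwa [mul_pow, ← mul_assoc] at this

lemma integrable_gaussian_mul_pow_zero (j : ℕ) :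
    MeasureTheory.Integrable fun u : ℝ => Real.exp (-(1 / 4) * u ^ 2) * (1 + |u|) ^ j := by
  refine ((integrable_exp_neg_mul_sq (b := 1 / 8) (by norm_num)).const_mul
    (j.factorial * Real.exp 3)).mono' (by fun_prop) (Filter.Eventually.of_forall fun u => ?_)
  rw [Real.norm_of_nonneg (by positivity)]
  have h1 : (1 + |u|) ^ j ≤ j.factorial * Real.exp (1 + |u|) := by
    have := Real.pow_div_factorial_le_exp (1 + |u|) (by positivity) j
    rwa [div_le_iff₀' (by positivity)] at this
  calc Real.exp (-(1 / 4) * u ^ 2) * (1 + |u|) ^ j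
      ≤ Real.exp (-(1 / 4) * u ^ 2) * (j.factorial * Real.exp (1 + |u|)) := by gcongr
    _ = j.factorial * Real.exp (-(1 / 4) * u ^ 2 + (1 + |u|)) := by
        rw [Real.exp_add (-(1 / 4) * u ^ 2)]; ring
    _ ≤ j.factorial * Real.exp (3 + -(1 / 8) * u ^ 2) := by
        refine mul_le_mul_of_nonneg_left (Real.exp_le_exp.mpr ?_) (by positivity)
        nlinarith [sq_nonneg (|u| - 4), sq_abs u]
    _ = _ := by rw [Real.exp_add]; ring

lemma one_add_abs_pow_le (τ v : ℝ) (j : ℕ) :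
    (1 + |v|) ^ j ≤ (1 + |τ|) ^ j * (1 + |τ - v|) ^ j := by
  rw [← mul_pow]
  gcongr
  have h1 : |v| ≤ |τ| + |τ - v| := by
    calc |v| = |τ - (τ - v)| := by rw [sub_sub_cancel]
      _ ≤ _ := abs_sub _ _
  nlinarith [mul_nonneg (abs_nonneg τ) (abs_nonneg (τ - v))]

lemma integrable_gaussian_mul_pow (τ : ℝ) (j : ℕ) :
    MeasureTheory.Integrable fun v : ℝ =>
      Real.exp (-(1 / 4) * (τ - v) ^ 2) * (1 + |v|) ^ j := by
  refine (((integrable_gaussian_mul_pow_zero j).comp_sub_left τ).const_mul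
    ((1 + |τ|) ^ j)).mono' (by fun_prop) (Filter.Eventually.of_forall fun v => ?_)
  rw [Real.norm_of_nonneg (by positivity)]
  calc _ ≤ Real.exp (-(1 / 4) * (τ - v) ^ 2) * ((1 + |τ|) ^ j * (1 + |τ - v|) ^ j) := by
        gcongr; exact one_add_abs_pow_le τ v j
    _ = _ := by ring

/-- The moment `∫ exp (-u² / 4) (1 + |u|) ^ j`. -/
noncomputable def gaussianMoment (j : ℕ) : ℝ :=
  ∫ u : ℝ, Real.exp (-(1 / 4) * u ^ 2) * (1 + |u|) ^ j

lemma gaussianMoment_nonneg (j : ℕ) : 0 ≤ gaussianMoment j :=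
  MeasureTheory.integral_nonneg fun _ => by positivity

lemma integral_gaussian_mul_pow_le (τ : ℝ) (j : ℕ) :
    ∫ v : ℝ, Real.exp (-(1 / 4) * (τ - v) ^ 2) * (1 + |v|) ^ j ≤
      (1 + |τ|) ^ j * gaussianMoment j := by
  have h := MeasureTheory.integral_sub_left_eq_self
    (fun u : ℝ => Real.exp (-(1 / 4) * u ^ 2) * (1 + |u|) ^ j) MeasureTheory.volume τ
  rw [gaussianMoment, ← h, ← MeasureTheory.integral_const_mul]
  refine MeasureTheory.integral_mono (integrable_gaussian_mul_pow τ j)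
    (((integrable_gaussian_mul_pow_zero j).comp_sub_left τ).const_mul _) fun v => ?_
  calc _ ≤ Real.exp (-(1 / 4) * (τ - v) ^ 2) * ((1 + |τ|) ^ j * (1 + |τ - v|) ^ j) := by
        gcongr; exact one_add_abs_pow_le τ v j
    _ = _ := by ring

/-! ### The dual bound for Fourier transforms of the weight. -/

lemma one_div_ofReal_mul_cpow {r : ℝ} (hr : 0 < r) {w : ℂ} (hw : 0 < w.re) (a : ℂ) :
    (1 / ((r : ℂ) * w)) ^ a = (r : ℂ) ^ (-a) * (1 / w) ^ a := by
  have hw0 : w ≠ 0 := fun h => by simp [h] at hw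
  have hrc : (r : ℂ) ≠ 0 := by exact_mod_cast hr.ne'
  have e : (1 / ((r : ℂ) * w)) = ((r⁻¹ : ℝ) : ℂ) * (1 / w) := by
    push_cast; field_simp
  have h1w : 1 / w ≠ 0 := one_div_ne_zero hw0
  have h0 : ((r⁻¹ : ℝ) : ℂ) * (1 / w) ≠ 0 := mul_ne_zero (by simpa using hrc) h1w
  rw [e, Complex.cpow_def_of_ne_zero h0, Complex.log_ofReal_mul (by positivity) h1w,
    Complex.cpow_def_of_ne_zero hrc, Complex.cpow_def_of_ne_zero h1w, ← Complex.exp_add,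
    Real.log_inv, ← Complex.ofReal_log hr.le]
  congr 1
  push_cast
  ring

/-- Since |arg(1/w)| ≤ π/2, the growth in v is at most exp(π|v|/2), exactly what the decay of Γ
compensates. The bound is therefore uniform as w approaches the imaginary axis. -/
lemma norm_one_div_cpow_le {w : ℂ} (hw : 0 < w.re) (hw1 : 1 ≤ ‖w‖) (j : ℕ) (v : ℝ) :
    ‖(1 / w) ^ ((1 / 2 + j : ℂ) + (v : ℂ) * Complex.I)‖ ≤ Real.exp (Real.pi / 2 * |v|) := by
  have hw0 : w ≠ 0 := fun h => by simp [h] at hw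
  have hre : ((1 / 2 + j : ℂ) + (v : ℂ) * Complex.I).re = 1 / 2 + j := by simp
  have him : ((1 / 2 + j : ℂ) + (v : ℂ) * Complex.I).im = v := by simp
  rw [Complex.norm_cpow_of_ne_zero (one_div_ne_zero hw0), hre, him, div_eq_mul_inv, ← Real.exp_neg]
  have hb : ‖1 / w‖ ^ (1 / 2 + j : ℝ) ≤ 1 := by
    refine Real.rpow_le_one (norm_nonneg _) ?_ (by positivity)
    rw [norm_div, norm_one]
    exact (div_le_one (by linarith)).mpr hw1
  have harg : |(1 / w).arg| ≤ Real.pi / 2 := by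
    rw [Complex.abs_arg_le_pi_div_two_iff, one_div, Complex.inv_re]
    exact (div_pos hw (Complex.normSq_pos.mpr hw0)).le
  calc _ ≤ 1 * Real.exp (-((1 / w).arg * v)) := by gcongr
    _ ≤ Real.exp (Real.pi / 2 * |v|) := by
        rw [one_mul]
        refine Real.exp_le_exp.mpr ((neg_le_abs _).trans ?_)
        rw [abs_mul]
        gcongr

/-- The constant in the dual bound for Laplace transforms of `logNormal`. -/
noncomputable def dualConst (j : ℕ) : ℝ :=
  (2 * √Real.pi)⁻¹ * (Real.exp ((-(j : ℝ)) ^ 2 / 4) * (√(2 * Real.pi) * (j + 1) ^ j))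

lemma dualConst_nonneg (j : ℕ) : 0 ≤ dualConst j := by unfold dualConst; positivity

lemma measurable_Gamma_line (j : ℕ) :
    Measurable fun v : ℝ => Complex.Gamma ((1 / 2 + j : ℂ) + (v : ℂ) * Complex.I) := by
  refine Continuous.measurable (continuous_iff_continuousAt.mpr fun v => ?_)
  have h : ContinuousAt Complex.Gamma ((1 / 2 + j : ℂ) + (v : ℂ) * Complex.I) := by
    refine (Complex.differentiableAt_Gamma _ fun m hm => ?_).continuousAt
    have h1 := congrArg Complex.re hm
    simp only [Complex.add_re, Complex.mul_re, Complex.ofReal_re, Complex.I_re, mul_zero,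
      Complex.ofReal_im, Complex.I_im, mul_one, sub_self, add_zero, Complex.neg_re,
      Complex.natCast_re] at h1
    norm_num at h1
    have h2 : (0 : ℝ) ≤ m := by positivity
    have h3 : (0 : ℝ) ≤ j := by positivity
    linarith
  exact ContinuousAt.comp (f := fun v : ℝ => (1 / 2 + j : ℂ) + (v : ℂ) * Complex.I) h (by fun_prop)

/-- The points l i enter `laplace_logNormal` only through the factor (l i)^(-(1/2 + j + iv)), so the
sum over i stays inside the absolute value. With j = 0 this produces the dual Dirichlet polynomial;
larger j serve to bound the tail of the dual sum. -/
lemma norm_sum_laplace_logNormal_le {N : ℝ} (hN : 0 < N) (τ : ℝ) (j : ℕ) {κ : Type*}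
    (s : Finset κ) {l : κ → ℝ} (hl : ∀ i ∈ s, 0 < l i) {w : ℂ} (hw : 0 < w.re) (hw1 : 1 ≤ ‖w‖) :
    ‖∑ i ∈ s, ∫ y in Set.Ioi (0 : ℝ), logNormal N τ y * Complex.exp (-(((l i : ℂ) * w) * y))‖ ≤
      dualConst j * N ^ (-(j : ℝ)) * ∫ v : ℝ, Real.exp (-(1 / 4) * (τ - v) ^ 2) * (1 + |v|) ^ j *
        ‖∑ i ∈ s, (l i : ℂ) ^ (-((1 / 2 + j : ℂ) + (v : ℂ) * Complex.I))‖ := by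
  set B : ℝ → ℂ := fun v =>
    Complex.exp ((((-(j : ℝ) : ℝ) : ℂ) + ((τ - v : ℝ) : ℂ) * Complex.I) ^ 2 / 4) *
        (N : ℂ) ^ (((-(j : ℝ) : ℝ) : ℂ) + ((τ - v : ℝ) : ℂ) * Complex.I) *
        ((1 / w) ^ ((1 / 2 + j : ℂ) + (v : ℂ) * Complex.I) *
          Complex.Gamma ((1 / 2 + j : ℂ) + (v : ℂ) * Complex.I)) with hB
  have hBn : ∀ v, ‖B v‖ ≤ Real.exp ((-(j : ℝ)) ^ 2 / 4) * (√(2 * Real.pi) * (j + 1) ^ j) *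
      N ^ (-(j : ℝ)) * (Real.exp (-(1 / 4) * (τ - v) ^ 2) * (1 + |v|) ^ j) := by
    intro v
    rw [hB, norm_mul, norm_mul, norm_cexp_line, Complex.norm_cpow_eq_rpow_re_of_pos hN, norm_mul]
    have e : (((-(j : ℝ) : ℝ) : ℂ) + ((τ - v : ℝ) : ℂ) * Complex.I).re = -(j : ℝ) := by
      simp only [Complex.add_re, Complex.ofReal_re, Complex.mul_re, Complex.I_re, mul_zero,
        Complex.ofReal_im, Complex.I_im, mul_one, sub_self, add_zero]
    rw [e]
    have h1 : ‖(1 / w) ^ ((1 / 2 + j : ℂ) + (v : ℂ) * Complex.I)‖ *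
        ‖Complex.Gamma ((1 / 2 + j : ℂ) + (v : ℂ) * Complex.I)‖ ≤
        √(2 * Real.pi) * (j + 1) ^ j * (1 + |v|) ^ j := by
      refine le_trans ?_ (norm_Gamma_shifted_line j v)
      rw [mul_comm]
      gcongr
      exact norm_one_div_cpow_le hw hw1 j v
    calc _ ≤ Real.exp ((-(j : ℝ)) ^ 2 / 4) * Real.exp (-(1 / 4) * (τ - v) ^ 2) *
          N ^ (-(j : ℝ)) * (√(2 * Real.pi) * (j + 1) ^ j * (1 + |v|) ^ j) := by gcongr
      _ = _ := by ring
  have hBm : Measurable B := by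
    refine Measurable.mul (by fun_prop) (Measurable.mul (by fun_prop) (measurable_Gamma_line j))
  have hBi : MeasureTheory.Integrable B :=
    ((integrable_gaussian_mul_pow τ j).const_mul _).mono' hBm.aestronglyMeasurable
      (Filter.Eventually.of_forall hBn)
  have hln : ∀ i ∈ s, ∀ v : ℝ, ‖(l i : ℂ) ^ (-((1 / 2 + j : ℂ) + (v : ℂ) * Complex.I))‖ =
      l i ^ (-(1 / 2 + j : ℝ)) := by
    intro i hi v
    rw [Complex.norm_cpow_eq_rpow_re_of_pos (hl i hi)]
    simp
  have hint : ∀ i ∈ s, MeasureTheory.Integrable fun v : ℝ =>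
      (l i : ℂ) ^ (-((1 / 2 + j : ℂ) + (v : ℂ) * Complex.I)) * B v := fun i hi =>
    hBi.bdd_mul (c := l i ^ (-(1 / 2 + j : ℝ)))
      (Measurable.aestronglyMeasurable (by fun_prop))
      (Filter.Eventually.of_forall fun v => (hln i hi v).le)
  have hterm : ∀ i ∈ s, ∫ y in Set.Ioi (0 : ℝ), logNormal N τ y *
      Complex.exp (-(((l i : ℂ) * w) * y)) = ((2 * √Real.pi : ℝ) : ℂ)⁻¹ *
      ∫ v : ℝ, (l i : ℂ) ^ (-((1 / 2 + j : ℂ) + (v : ℂ) * Complex.I)) * B v := by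
    intro i hi
    have hre : 0 < ((l i : ℂ) * w).re := by
      rw [Complex.re_ofReal_mul]; exact mul_pos (hl i hi) hw
    rw [laplace_logNormal hN τ j hre]
    congr 1
    refine MeasureTheory.integral_congr_ae (Filter.Eventually.of_forall fun v => ?_)
    simp only [hB]
    rw [one_div_ofReal_mul_cpow (hl i hi) hw]
    ring
  rw [Finset.sum_congr rfl hterm, ← Finset.mul_sum, ← MeasureTheory.integral_finsetSum s hint,
    norm_mul, norm_inv, Complex.norm_real, Real.norm_of_nonneg (by positivity)]
  have hle : ‖∫ v : ℝ, ∑ i ∈ s, (l i : ℂ) ^ (-((1 / 2 + j : ℂ) + (v : ℂ) * Complex.I)) * B v‖ ≤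
      ∫ v : ℝ, Real.exp ((-(j : ℝ)) ^ 2 / 4) * (√(2 * Real.pi) * (j + 1) ^ j) *
      N ^ (-(j : ℝ)) * (Real.exp (-(1 / 4) * (τ - v) ^ 2) * (1 + |v|) ^ j *
        ‖∑ i ∈ s, (l i : ℂ) ^ (-((1 / 2 + j : ℂ) + (v : ℂ) * Complex.I))‖) := by
    refine MeasureTheory.norm_integral_le_of_norm_le ?_ (Filter.Eventually.of_forall fun v => ?_)
    · refine MeasureTheory.Integrable.const_mul ?_ _
      refine (integrable_gaussian_mul_pow τ j).mul_bdd (c := ∑ i ∈ s, l i ^ (-(1 / 2 + j : ℝ)))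
        (Measurable.aestronglyMeasurable (by fun_prop)) (Filter.Eventually.of_forall fun v => ?_)
      rw [norm_norm]
      exact (norm_sum_le _ _).trans (Finset.sum_le_sum fun i hi => (hln i hi v).le)
    · rw [← Finset.sum_mul, norm_mul, mul_comm]
      calc _ ≤ Real.exp ((-(j : ℝ)) ^ 2 / 4) * (√(2 * Real.pi) * (j + 1) ^ j) *
            N ^ (-(j : ℝ)) * (Real.exp (-(1 / 4) * (τ - v) ^ 2) * (1 + |v|) ^ j) *
            ‖∑ i ∈ s, (l i : ℂ) ^ (-((1 / 2 + j : ℂ) + (v : ℂ) * Complex.I))‖ := by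
              gcongr; exact hBn v
        _ = _ := by ring
  rw [MeasureTheory.integral_const_mul] at hle
  exact (mul_le_mul_of_nonneg_left hle (by positivity)).trans (le_of_eq (by rw [dualConst]; ring))

/-- The previous bound at w = δ + iθ, for which |w| ≥ |θ| = 1, followed by δ → 0⁺ under dominated
convergence. -/
lemma norm_sum_oscillatory_logNormal_le {N : ℝ} (hN : 0 < N) (τ : ℝ) (j : ℕ) {κ : Type*}
    (s : Finset κ) {l : κ → ℝ} (hl : ∀ i ∈ s, 0 < l i) {θ : ℝ} (hθ : |θ| = 1) :
    ‖∑ i ∈ s, ∫ y in Set.Ioi (0 : ℝ), logNormal N τ y *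
        Complex.exp (-(((l i : ℂ) * (θ * Complex.I)) * y))‖ ≤
      dualConst j * N ^ (-(j : ℝ)) * ∫ v : ℝ, Real.exp (-(1 / 4) * (τ - v) ^ 2) * (1 + |v|) ^ j *
        ‖∑ i ∈ s, (l i : ℂ) ^ (-((1 / 2 + j : ℂ) + (v : ℂ) * Complex.I))‖ := by
  have ht : Filter.Tendsto (fun δ : ℝ => ∑ i ∈ s, ∫ y in Set.Ioi (0 : ℝ), logNormal N τ y *
      Complex.exp (-(((l i : ℂ) * (δ + θ * Complex.I)) * y))) (nhdsWithin 0 (Set.Ioi 0))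
      (nhds (∑ i ∈ s, ∫ y in Set.Ioi (0 : ℝ), logNormal N τ y *
        Complex.exp (-(((l i : ℂ) * (θ * Complex.I)) * y)))) := by
    refine tendsto_finsetSum _ fun i hi => ?_
    refine MeasureTheory.tendsto_integral_filter_of_dominated_convergence
      (fun y => ‖logNormal N τ y‖) ?_ ?_ ((integrable_logNormal hN τ).norm.integrableOn) ?_
    · refine Filter.Eventually.of_forall fun δ => ?_
      exact ((continuous_logNormal hN τ).mul (by fun_prop)).aestronglyMeasurable
    · filter_upwards [self_mem_nhdsWithin] with δ hδ
      filter_upwards [MeasureTheory.ae_restrict_mem measurableSet_Ioi] with y hy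
      rw [norm_mul, Complex.norm_exp]
      refine mul_le_of_le_one_right (norm_nonneg _) (Real.exp_le_one_iff.mpr ?_)
      have e : (-(((l i : ℂ) * (δ + θ * Complex.I)) * y)).re = -(l i * δ * y) := by simp
      rw [e, neg_nonpos]
      have := hl i hi
      have h1 : (0 : ℝ) < δ := hδ
      have h2 : (0 : ℝ) < y := hy
      positivity
    · refine Filter.Eventually.of_forall fun y => ?_
      have hc : Continuous fun δ : ℝ => logNormal N τ y *
          Complex.exp (-(((l i : ℂ) * (δ + θ * Complex.I)) * y)) := by fun_prop
      have := (hc.tendsto 0).mono_left (nhdsWithin_le_nhds (s := Set.Ioi 0))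
      simpa using this
  refine le_of_tendsto ht.norm ?_
  filter_upwards [self_mem_nhdsWithin] with δ hδ
  have h1 : (0 : ℝ) < δ := hδ
  refine norm_sum_laplace_logNormal_le hN τ j s hl (by simpa using h1) ?_
  calc (1 : ℝ) = |((δ : ℂ) + θ * Complex.I).im| := by simp [hθ]
    _ ≤ _ := Complex.abs_im_le_norm _

open FourierTransform in
lemma fourier_logNormal (N τ ξ : ℝ) :
    𝓕 (logNormal N τ) ξ = ∫ y in Set.Ioi (0 : ℝ), logNormal N τ y *
      Complex.exp (-((2 * Real.pi * ξ * Complex.I) * y)) := by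
  rw [Real.fourier_real_eq_integral_exp_smul,
    ← MeasureTheory.setIntegral_eq_integral_of_forall_compl_eq_zero (s := Set.Ioi (0 : ℝ))]
  · refine MeasureTheory.integral_congr_ae (Filter.Eventually.of_forall fun y => ?_)
    simp only [smul_eq_mul]
    rw [mul_comm]
    congr 2
    push_cast
    ring
  · intro y hy
    rw [logNormal, if_neg (show ¬ 0 < y from hy), smul_zero]

open FourierTransform in
lemma norm_sum_fourier_logNormal_le {N : ℝ} (hN : 0 < N) (τ : ℝ) (j : ℕ) {κ : Type*}
    (s : Finset κ) {l : κ → ℝ} (hl : ∀ i ∈ s, 0 < l i) {θ : ℝ} (hθ : |θ| = 1) :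
    ‖∑ i ∈ s, 𝓕 (logNormal N τ) (θ * l i)‖ ≤
      dualConst j * N ^ (-(j : ℝ)) * ∫ v : ℝ, Real.exp (-(1 / 4) * (τ - v) ^ 2) * (1 + |v|) ^ j *
        ‖∑ i ∈ s, (l i : ℂ) ^ (-((1 / 2 + j : ℂ) + (v : ℂ) * Complex.I))‖ := by
  have h2pi : 0 < 2 * Real.pi := by positivity
  have h := norm_sum_oscillatory_logNormal_le hN τ j s (l := fun i => 2 * Real.pi * l i)
    (fun i hi => mul_pos h2pi (hl i hi)) hθ
  have e : ∀ i ∈ s, 𝓕 (logNormal N τ) (θ * l i) = ∫ y in Set.Ioi (0 : ℝ), logNormal N τ y *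
        Complex.exp (-((((2 * Real.pi * l i : ℝ) : ℂ) * (θ * Complex.I)) * y)) := by
    intro i _
    rw [fourier_logNormal]
    congr 1 with y
    congr 3
    push_cast
    ring
  rw [Finset.sum_congr rfl e]
  refine h.trans ?_
  -- The powers of 2π form a common factor of modulus at most 1.
  have hpt : ∀ v : ℝ, ‖∑ i ∈ s, ((2 * Real.pi * l i : ℝ) : ℂ) ^
      (-((1 / 2 + j : ℂ) + (v : ℂ) * Complex.I))‖ ≤
      ‖∑ i ∈ s, (l i : ℂ) ^ (-((1 / 2 + j : ℂ) + (v : ℂ) * Complex.I))‖ := by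
    intro v
    have e2 : ∀ i ∈ s, ((2 * Real.pi * l i : ℝ) : ℂ) ^ (-((1 / 2 + j : ℂ) + (v : ℂ) * Complex.I)) =
        ((2 * Real.pi : ℝ) : ℂ) ^ (-((1 / 2 + j : ℂ) + (v : ℂ) * Complex.I)) *
        (l i : ℂ) ^ (-((1 / 2 + j : ℂ) + (v : ℂ) * Complex.I)) := by
      intro i hi
      rw [Complex.ofReal_mul, Complex.mul_cpow_ofReal_nonneg h2pi.le (hl i hi).le]
    rw [Finset.sum_congr rfl e2, ← Finset.mul_sum, norm_mul,
      Complex.norm_cpow_eq_rpow_re_of_pos h2pi]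
    refine mul_le_of_le_one_left (norm_nonneg _) ?_
    refine Real.rpow_le_one_of_one_le_of_nonpos ?_ ?_
    · nlinarith [Real.pi_gt_three]
    · have e3 : (-((1 / 2 + j : ℂ) + (v : ℂ) * Complex.I)).re = -(1 / 2 + j : ℝ) := by simp
      rw [e3, neg_nonpos]
      positivity
  have hbdd : ∀ v : ℝ, ‖∑ i ∈ s, (l i : ℂ) ^ (-((1 / 2 + j : ℂ) + (v : ℂ) * Complex.I))‖ ≤
      ∑ i ∈ s, l i ^ (-(1 / 2 + j : ℝ)) := by
    intro v
    refine (norm_sum_le _ _).trans (Finset.sum_le_sum fun i hi => ?_)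
    rw [Complex.norm_cpow_eq_rpow_re_of_pos (hl i hi)]
    simp
  have hi2 : MeasureTheory.Integrable fun v : ℝ => Real.exp (-(1 / 4) * (τ - v) ^ 2) *
      (1 + |v|) ^ j * ‖∑ i ∈ s, (l i : ℂ) ^ (-((1 / 2 + j : ℂ) + (v : ℂ) * Complex.I))‖ :=
    (integrable_gaussian_mul_pow τ j).mul_bdd (c := ∑ i ∈ s, l i ^ (-(1 / 2 + j : ℝ)))
        (Measurable.aestronglyMeasurable (by fun_prop)) (Filter.Eventually.of_forall fun v => by
          rw [norm_norm]; exact hbdd v)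
  refine mul_le_mul_of_nonneg_left ?_ (mul_nonneg (dualConst_nonneg j) (by positivity))
  refine MeasureTheory.integral_mono_of_nonneg (Filter.Eventually.of_forall fun v => ?_) hi2
    (Filter.Eventually.of_forall fun v => ?_)
  · simp only [Pi.zero_apply]; positivity
  · simp only
    gcongr
    exact hpt v

open FourierTransform in
lemma norm_fourier_logNormal_le {N : ℝ} (hN : 0 < N) (τ : ℝ) (j : ℕ) {ξ : ℝ} (hξ : 1 ≤ |ξ|) :
    ‖𝓕 (logNormal N τ) ξ‖ ≤
      dualConst j * gaussianMoment j * ((1 + |τ|) / (N * |ξ|)) ^ j := by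
  have hξ0 : 0 < |ξ| := by linarith
  have hθ : abs (ξ / |ξ|) = 1 := by rw [abs_div, abs_abs, div_self hξ0.ne']
  have h := norm_sum_fourier_logNormal_le hN τ j ({()} : Finset Unit) (l := fun _ => |ξ|)
    (fun _ _ => hξ0) hθ
  simp only [Finset.sum_singleton] at h
  rw [div_mul_cancel₀ _ hξ0.ne'] at h
  refine h.trans ?_
  have e : ∀ v : ℝ, ‖((|ξ| : ℝ) : ℂ) ^ (-((1 / 2 + j : ℂ) + (v : ℂ) * Complex.I))‖ =
      |ξ| ^ (-(1 / 2 + j : ℝ)) := by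
    intro v
    rw [Complex.norm_cpow_eq_rpow_re_of_pos hξ0]
    simp
  simp_rw [e]
  rw [MeasureTheory.integral_mul_const]
  have h1 : |ξ| ^ (-(1 / 2 + j : ℝ)) ≤ (|ξ| ^ j)⁻¹ := by
    rw [← Real.rpow_natCast, ← Real.rpow_neg hξ0.le]
    exact Real.rpow_le_rpow_of_exponent_le hξ (by linarith)
  have h2 : N ^ (-(j : ℝ)) = (N ^ j)⁻¹ := by rw [Real.rpow_neg hN.le, Real.rpow_natCast]
  have hK := dualConst_nonneg j
  have hG := gaussianMoment_nonneg j
  rw [h2]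
  calc _ ≤ dualConst j * (N ^ j)⁻¹ * (((1 + |τ|) ^ j * gaussianMoment j) * (|ξ| ^ j)⁻¹) := by
        gcongr
        exact integral_gaussian_mul_pow_le τ j
    _ = _ := by rw [div_pow, mul_pow]; field_simp

open FourierTransform in
-- The substitution y = N e^t turns the integral into a Gaussian one. The factor exp(-τ²/4) is what
-- confines the zero frequency to pairs of nearby points.
lemma norm_fourier_logNormal_zero {N : ℝ} (hN : 0 < N) (τ : ℝ) :
    ‖𝓕 (logNormal N τ) 0‖ =
      √Real.pi * Real.exp (1 / 16) * (√N * Real.exp (-(1 / 4) * τ ^ 2)) := by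
  rw [fourier_logNormal]
  simp only [Complex.ofReal_zero, mul_zero, zero_mul, neg_zero, Complex.exp_zero, mul_one]
  have himg : (fun t : ℝ => N * Real.exp t) '' Set.univ = Set.Ioi 0 := by
    ext y
    simp only [Set.image_univ, Set.mem_range, Set.mem_Ioi]
    constructor
    · rintro ⟨t, rfl⟩; positivity
    · intro hy
      exact ⟨Real.log (y / N), by rw [Real.exp_log (by positivity)]; field_simp⟩
  have hder : ∀ t ∈ Set.univ, HasDerivWithinAt (fun t : ℝ => N * Real.exp t) (N * Real.exp t)
      Set.univ t := fun t _ => ((Real.hasDerivAt_exp t).const_mul N).hasDerivWithinAt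
  have hinj : Set.InjOn (fun t : ℝ => N * Real.exp t) Set.univ := fun a _ b _ h =>
    Real.exp_injective (mul_left_cancel₀ hN.ne' h)
  rw [← himg, MeasureTheory.integral_image_eq_integral_abs_deriv_smul MeasurableSet.univ hder hinj,
    MeasureTheory.setIntegral_univ]
  have e : ∀ t : ℝ, |N * Real.exp t| • logNormal N τ (N * Real.exp t) =
      Complex.exp (-1 * (t : ℂ) ^ 2 + (1 / 2 + τ * Complex.I) * t +
        (1 / 2 + τ * Complex.I) * Real.log N) := by
    intro t
    have hpos : 0 < N * Real.exp t := by positivity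
    have hNc : (((N * Real.exp t : ℝ)) : ℂ) ≠ 0 := by exact_mod_cast hpos.ne'
    have h1 : (((N * Real.exp t : ℝ)) : ℂ) = Complex.exp (Real.log N + t) := by
      rw [← Complex.ofReal_add, ← Complex.ofReal_exp, Real.exp_add, Real.exp_log hN]
    rw [abs_of_pos hpos, logNormal, if_pos hpos, mul_div_cancel_left₀ _ hN.ne', Real.log_exp,
      Complex.real_smul, Complex.cpow_def_of_ne_zero hNc, ← Complex.ofReal_log hpos.le,
      Real.log_mul hN.ne' (Real.exp_pos t).ne', Real.log_exp, h1, Complex.ofReal_exp,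
      ← Complex.exp_add, ← Complex.exp_add]
    congr 1
    push_cast
    ring
  simp_rw [e]
  rw [integral_cexp_quadratic (by norm_num), norm_mul, Complex.norm_exp]
  have h1 : ((Real.pi : ℂ) / -(-1)) ^ (1 / 2 : ℂ) = ((√Real.pi : ℝ) : ℂ) := by
    rw [neg_neg, div_one, show (1 / 2 : ℂ) = ((1 / 2 : ℝ) : ℂ) by push_cast; rfl,
      ← Complex.ofReal_cpow (by positivity), ← Real.sqrt_eq_rpow]
  have h2 : ((1 / 2 + τ * Complex.I) * Real.log N -
      (1 / 2 + τ * Complex.I) ^ 2 / (4 * (-1)) : ℂ) =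
      ((1 / 2 * Real.log N + 1 / 16 - 1 / 4 * τ ^ 2 : ℝ) : ℂ) +
      ((τ * Real.log N + τ / 4 : ℝ) : ℂ) * Complex.I := by
    push_cast
    linear_combination ((τ : ℂ) ^ 2 / 4) * Complex.I_sq
  rw [h1, h2, Complex.norm_real, Real.norm_of_nonneg (by positivity)]
  simp only [Complex.add_re, Complex.ofReal_re, Complex.mul_re, Complex.I_re, mul_zero,
    Complex.ofReal_im, Complex.I_im, mul_one, sub_self, add_zero]
  rw [Real.sqrt_eq_rpow N, Real.rpow_def_of_pos hN, mul_assoc, ← Real.exp_add, ← Real.exp_add]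
  congr 2
  ring

open FourierTransform in
lemma norm_fourier_logNormal_mul_le {N : ℝ} (hN : 0 < N) (τ : ℝ) (j : ℕ) {θ : ℝ} (hθ : |θ| = 1)
    (n : ℕ) : ‖𝓕 (logNormal N τ) (θ * (n + 1))‖ ≤
      dualConst j * gaussianMoment j * ((1 + |τ|) / (N * (n + 1))) ^ j := by
  have h : |θ * ((n : ℝ) + 1)| = n + 1 := by
    rw [abs_mul, hθ, one_mul, abs_of_pos (by positivity)]
  have h1 := norm_fourier_logNormal_le hN τ j (ξ := θ * (n + 1)) (by rw [h]; simp)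
  rwa [h] at h1

/-! ### Poisson summation and the pointwise reflection principle. -/

lemma summable_one_div_succ_sq : Summable fun n : ℕ => 1 / ((n : ℝ) + 1) ^ 2 := by
  have := (summable_nat_add_iff 1).mpr (Real.summable_one_div_nat_pow.mpr one_lt_two)
  simpa using this

open FourierTransform in
lemma summable_fourier_logNormal {N : ℝ} (hN : 0 < N) (τ : ℝ) {θ : ℝ} (hθ : |θ| = 1) :
    Summable fun n : ℕ => 𝓕 (logNormal N τ) (θ * (n + 1)) := by
  refine Summable.of_norm_bounded (summable_one_div_succ_sq.mul_left
    (dualConst 2 * gaussianMoment 2 * ((1 + |τ|) / N) ^ 2)) fun n => ?_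
  refine (norm_fourier_logNormal_mul_le hN τ 2 hθ n).trans (le_of_eq ?_)
  rw [div_pow, div_pow, mul_pow]
  field_simp

open FourierTransform in
lemma hasSum_fourier_logNormal {N : ℝ} (hN : 0 < N) (τ : ℝ) :
    HasSum (fun n : ℤ => 𝓕 (logNormal N τ) n)
      ((𝓕 (logNormal N τ) 0 + ∑' n : ℕ, 𝓕 (logNormal N τ) (1 * (n + 1))) +
        ∑' n : ℕ, 𝓕 (logNormal N τ) (-1 * (n + 1))) := by
  refine HasSum.of_nat_of_neg_add_one ?_ ?_
  · rw [← hasSum_nat_add_iff' 1]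
    simpa using (summable_fourier_logNormal hN τ (θ := 1) (by simp)).hasSum
  · simpa [add_comm] using (summable_fourier_logNormal hN τ (θ := -1) (by simp)).hasSum

open FourierTransform in
lemma tsum_logNormal {N : ℝ} (hN : 0 < N) (τ : ℝ) :
    ∑' n : ℤ, logNormal N τ n =
      (𝓕 (logNormal N τ) 0 + ∑' n : ℕ, 𝓕 (logNormal N τ) (1 * (n + 1))) +
        ∑' n : ℕ, 𝓕 (logNormal N τ) (-1 * (n + 1)) := by
  have hs := hasSum_fourier_logNormal hN τ
  obtain ⟨C, hC0, hC⟩ := exists_norm_logNormal_le hN τ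
  have hO : (logNormal N τ) =O[Filter.cocompact ℝ] (fun x => |x| ^ (-2 : ℝ)) := by
    refine Asymptotics.IsBigO.of_bound C (Filter.Eventually.of_forall fun y => ?_)
    rcases le_or_gt y 0 with hy | hy
    · rw [logNormal, if_neg (not_lt.mpr hy), norm_zero]; positivity
    · refine (hC y).trans ?_
      rw [Real.norm_of_nonneg (by positivity), Real.rpow_neg (abs_nonneg y), abs_of_pos hy,
        Real.rpow_two]
      gcongr
      linarith
  have h := Real.tsum_eq_tsum_fourier_of_rpow_decay_of_summable (continuous_logNormal hN τ)
    one_lt_two hO hs.summable 0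
  rw [← hs.tsum_eq]
  simpa using h

/-- Complex conjugation changes n^(-1/2 - iv) into n^(-1/2 + iv) and keeps the modulus. -/
lemma norm_sum_cpow_half_eq (M : ℕ) (v : ℝ) :
    ‖∑ n ∈ Finset.range M, (((n : ℝ) + 1 : ℝ) : ℂ) ^
      (-((1 / 2 + (0 : ℕ) : ℂ) + (v : ℂ) * Complex.I))‖ =
    ‖∑ n ∈ Finset.Icc 1 M, (((√n)⁻¹ : ℝ) : ℂ) * (n : ℂ) ^ ((v : ℂ) * Complex.I)‖ := by
  have h1 : ∑ n ∈ Finset.Icc 1 M, (((√n)⁻¹ : ℝ) : ℂ) * (n : ℂ) ^ ((v : ℂ) * Complex.I) =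
      ∑ n ∈ Finset.range M, (((√(n + 1 : ℕ))⁻¹ : ℝ) : ℂ) *
        ((n + 1 : ℕ) : ℂ) ^ ((v : ℂ) * Complex.I) := by
    rw [Finset.range_eq_Ico, Finset.sum_Ico_add' (fun n : ℕ => (((√n)⁻¹ : ℝ) : ℂ) *
      (n : ℂ) ^ ((v : ℂ) * Complex.I)) 0 M 1]
    rfl
  rw [h1, ← RCLike.norm_conj, map_sum]
  congr 1
  refine Finset.sum_congr rfl fun n _ => ?_
  have hn : ((((n : ℝ) + 1 : ℝ)) : ℂ) = ((n + 1 : ℕ) : ℂ) := by push_cast; rfl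
  have hn0 : ((n + 1 : ℕ) : ℂ) ≠ 0 := by exact_mod_cast Nat.succ_ne_zero n
  rw [hn]
  have e : (-((1 / 2 + (0 : ℕ) : ℂ) + (v : ℂ) * Complex.I)) =
      ((-(1 / 2) : ℝ) : ℂ) + ((-v : ℝ) : ℂ) * Complex.I := by push_cast; ring
  rw [e, Complex.cpow_add _ _ hn0, map_mul, conj_natCast_cpow_mul_I, Complex.ofReal_neg v, neg_neg]
  congr 1
  rw [← Complex.ofReal_natCast, ← Complex.ofReal_cpow (by positivity), Complex.conj_ofReal,
    Real.rpow_neg (by positivity), Real.sqrt_eq_rpow]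

open FourierTransform in
lemma exists_norm_tsum_fourier_logNormal_le (i : ℕ) : ∃ C : ℝ, 0 < C ∧
    ∀ N T Q τ θ : ℝ, 1 ≤ N → 1 ≤ T → 0 < Q → T ^ 2 ≤ Q ^ i → |τ| ≤ T → |θ| = 1 →
      ‖∑' n : ℕ, 𝓕 (logNormal N τ) (θ * (n + 1))‖ ≤
        C * (1 + ∫ v : ℝ, Real.exp (-(1 / 4) * (τ - v) ^ 2) *
          ‖∑ n ∈ Finset.Icc 1 ⌊T * Q / N⌋₊,
            (((√n)⁻¹ : ℝ) : ℂ) * (n : ℂ) ^ ((v : ℂ) * Complex.I)‖) := by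
  set S : ℝ := ∑' n : ℕ, 1 / ((n : ℝ) + 1) ^ 2 with hS
  have hS0 : 0 ≤ S := tsum_nonneg fun n => by positivity
  set K : ℝ := dualConst (i + 2) * gaussianMoment (i + 2) with hK
  have hK0 : 0 ≤ K := mul_nonneg (dualConst_nonneg _) (gaussianMoment_nonneg _)
  have hd0 := dualConst_nonneg 0
  refine ⟨dualConst 0 + K * 2 ^ (i + 2) * S + 1, by positivity, ?_⟩
  intro N T Q τ θ hN hT hQ hTQ hτ hθ
  have hN0 : 0 < N := by linarith
  have hT0 : 0 < T := by linarith
  set M := ⌊T * Q / N⌋₊ with hM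
  have hsum := summable_fourier_logNormal hN0 τ hθ
  rw [← hsum.sum_add_tsum_nat_add M]
  set J : ℝ := ∫ v : ℝ, Real.exp (-(1 / 4) * (τ - v) ^ 2) *
          ‖∑ n ∈ Finset.Icc 1 M, (((√n)⁻¹ : ℝ) : ℂ) * (n : ℂ) ^ ((v : ℂ) * Complex.I)‖ with hJ
  have hJ0 : 0 ≤ J := MeasureTheory.integral_nonneg fun v => by positivity
  have hmain : ‖∑ n ∈ Finset.range M, 𝓕 (logNormal N τ) (θ * ((n : ℝ) + 1))‖ ≤ dualConst 0 * J := by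
    have h := norm_sum_fourier_logNormal_le hN0 τ 0 (Finset.range M) (l := fun n : ℕ => (n : ℝ) + 1)
      (fun _ _ => by positivity) hθ
    simp_rw [norm_sum_cpow_half_eq] at h
    simp only [pow_zero, mul_one, Nat.cast_zero, neg_zero, Real.rpow_zero] at h
    exact h
  -- Frequencies m > TQ/N are bounded individually with j = i + 2. Of the factors (1 + |τ|)/(Nm), i
  -- are at most 2/Q each, and two are at most 2T/(n + 1), which makes the sum over n converge; the
  -- hypothesis T² ≤ Q^i cancels the resulting T².
  have htail : ‖∑' n : ℕ, 𝓕 (logNormal N τ) (θ * (((n + M : ℕ) : ℝ) + 1))‖ ≤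
      K * 2 ^ (i + 2) * S := by
    rw [hS, ← tsum_mul_left]
    refine tsum_of_norm_bounded (summable_one_div_succ_sq.mul_left (K * 2 ^ (i + 2))).hasSum
      fun n => ?_
    refine (norm_fourier_logNormal_mul_le hN0 τ (i + 2) hθ (n + M)).trans ?_
    rw [← hK, mul_assoc K]
    refine mul_le_mul_of_nonneg_left ?_ hK0
    have hm : T * Q / N ≤ ((n + M : ℕ) : ℝ) + 1 := by
      have := Nat.lt_floor_add_one (T * Q / N)
      push_cast
      have h0 : (0 : ℝ) ≤ n := by positivity
      linarith
    have hmn : (n : ℝ) + 1 ≤ ((n + M : ℕ) : ℝ) + 1 := by push_cast; simp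
    set m : ℝ := ((n + M : ℕ) : ℝ) + 1 with hmdef
    have hm0 : 0 < m := by positivity
    have hτ2 : 1 + |τ| ≤ 2 * T := by linarith
    have ha : (1 + |τ|) / (N * m) ≤ 2 / Q := by
      rw [div_le_div_iff₀ (by positivity) hQ]
      rw [div_le_iff₀ hN0] at hm
      nlinarith
    have hb : (1 + |τ|) / (N * m) ≤ 2 * T / (n + 1) := by
      gcongr
      nlinarith
    calc ((1 + |τ|) / (N * m)) ^ (i + 2) =
          ((1 + |τ|) / (N * m)) ^ i * ((1 + |τ|) / (N * m)) ^ 2 := pow_add _ _ _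
      _ ≤ (2 / Q) ^ i * (2 * T / (n + 1)) ^ 2 := by gcongr
      _ = 2 ^ (i + 2) * (1 / ((n : ℝ) + 1) ^ 2) * (T ^ 2 / Q ^ i) := by
          rw [div_pow, div_pow, mul_pow, pow_add]; field_simp
      _ ≤ 2 ^ (i + 2) * (1 / ((n : ℝ) + 1) ^ 2) * 1 := by
          gcongr
          exact (div_le_one (by positivity)).mpr hTQ
      _ = _ := by rw [mul_one]
  calc _ ≤ dualConst 0 * J + K * 2 ^ (i + 2) * S := (norm_add_le _ _).trans (add_le_add hmain htail)
    _ ≤ _ := by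
        have h1 : 0 ≤ K * 2 ^ (i + 2) * S := by positivity
        nlinarith [mul_nonneg h1 hJ0]

/-- The reflection principle: a smoothed Dirichlet polynomial of length `N` at height at most `T`
is controlled by Dirichlet polynomials of length about `T / N`. -/
lemma exists_norm_tsum_logNormal_le (i : ℕ) : ∃ C : ℝ, 0 < C ∧
    ∀ N T Q τ : ℝ, 1 ≤ N → 1 ≤ T → 0 < Q → T ^ 2 ≤ Q ^ i → |τ| ≤ T →
      ‖∑' n : ℤ, logNormal N τ n‖ ≤
        C * (√N * Real.exp (-(1 / 4) * τ ^ 2) + 1 +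
          ∫ v : ℝ, Real.exp (-(1 / 4) * (τ - v) ^ 2) * ‖∑ n ∈ Finset.Icc 1 ⌊T * Q / N⌋₊,
            (((√n)⁻¹ : ℝ) : ℂ) * (n : ℂ) ^ ((v : ℂ) * Complex.I)‖) := by
  obtain ⟨C, hC, h⟩ := exists_norm_tsum_fourier_logNormal_le i
  refine ⟨2 * C + √Real.pi * Real.exp (1 / 16), by positivity, ?_⟩
  intro N T Q τ hN hT hQ hTQ hτ
  have hN0 : 0 < N := by linarith
  have h1 := h N T Q τ 1 hN hT hQ hTQ hτ (by simp)
  have h2 := h N T Q τ (-1) hN hT hQ hTQ hτ (by simp)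
  have h0 := norm_fourier_logNormal_zero hN0 τ
  rw [tsum_logNormal hN0 τ]
  set J : ℝ := ∫ v : ℝ, Real.exp (-(1 / 4) * (τ - v) ^ 2) * ‖∑ n ∈ Finset.Icc 1 ⌊T * Q / N⌋₊,
            (((√n)⁻¹ : ℝ) : ℂ) * (n : ℂ) ^ ((v : ℂ) * Complex.I)‖ with hJ
  have hJ0 : 0 ≤ J := MeasureTheory.integral_nonneg fun v => by positivity
  set G : ℝ := √N * Real.exp (-(1 / 4) * τ ^ 2) with hG
  have hG0 : 0 ≤ G := by positivity
  set c : ℝ := √Real.pi * Real.exp (1 / 16)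
  have hc0 : 0 ≤ c := by positivity
  calc _ ≤ c * G + C * (1 + J) + C * (1 + J) :=
        (norm_add_le _ _).trans (add_le_add ((norm_add_le _ _).trans (add_le_add h0.le h1)) h2)
    _ ≤ _ := by nlinarith [mul_nonneg hC.le hG0, mul_nonneg hc0 hJ0]

/-! ### The reflection principle in mean square. -/

/-- The number of pairs of points at distance at most `1`. -/
noncomputable def closePairs {ι : Type*} (I : Finset ι) (x : ι → ℝ) : ℕ :=
  ((I ×ˢ I).filter fun p => |x p.1 - x p.2| ≤ 1).card

lemma summable_inv_one_add_int_sq : Summable fun n : ℤ => (1 + (n : ℝ) ^ 2)⁻¹ := by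
  refine Summable.of_norm_bounded_eventually (Real.summable_one_div_int_pow.mpr one_lt_two) ?_
  have h0 : ∀ᶠ n : ℤ in Filter.cofinite, n ≠ 0 := Filter.eventually_cofinite_ne 0
  filter_upwards [h0] with n hn
  have : (n : ℝ) ≠ 0 := by exact_mod_cast hn
  rw [Real.norm_of_nonneg (by positivity), one_div]
  gcongr
  linarith

lemma summable_int_gaussian : Summable fun d : ℤ => Real.exp (1 / 2 - (d : ℝ) ^ 2 / 4) := by
  refine Summable.of_nonneg_of_le (fun _ => (Real.exp_pos _).le) (fun d => ?_)
    (summable_inv_one_add_int_sq.mul_left (4 * Real.exp (1 / 2)))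
  rw [sub_eq_add_neg, Real.exp_add, Real.exp_neg, mul_comm (4 : ℝ), mul_assoc]
  gcongr
  rw [← div_eq_mul_inv, inv_eq_one_div, div_le_div_iff₀ (Real.exp_pos _) (by positivity)]
  have := Real.add_one_le_exp ((d : ℝ) ^ 2 / 4)
  linarith

/-- A Schur test. Let r_k be the number of points with integer part k. The Gaussian at a difference
is dominated by G at the difference of integer parts, and r_k r_l ≤ (r_k² + r_l²)/2 leaves (∑ G) ∑
r_k². Points with equal integer part are at distance less than 1, so ∑ r_k² counts close pairs only.
-/
lemma sum_gaussian_le_closePairs {ι : Type*} (I : Finset ι) (x : ι → ℝ) :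
    ∑ u ∈ I, ∑ v ∈ I, Real.exp (-(1 / 2) * (x u - x v) ^ 2) ≤
      (∑' d : ℤ, Real.exp (1 / 2 - (d : ℝ) ^ 2 / 4)) * closePairs I x := by
  classical
  set G : ℤ → ℝ := fun d => Real.exp (1 / 2 - (d : ℝ) ^ 2 / 4) with hG
  have hGeven : ∀ k l : ℤ, G (k - l) = G (l - k) := by
    intro k l; simp only [hG]; congr 3; push_cast; ring
  have hG0 : ∀ d, 0 ≤ G d := fun d => (Real.exp_pos _).le
  set fl : ι → ℤ := fun u => ⌊x u⌋
  set K := I.image fl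
  set r : ℤ → ℕ := fun k => (I.filter fun u => fl u = k).card
  have hsum : ∀ k : ℤ, ∑ l ∈ K, G (k - l) ≤ ∑' d : ℤ, G d := by
    intro k
    rw [← (Equiv.subLeft k).tsum_eq]
    refine Summable.sum_le_tsum (f := fun l => G (Equiv.subLeft k l)) K (fun _ _ => hG0 _) ?_
    exact (Equiv.subLeft k).summable_iff.mpr summable_int_gaussian
  have hr : ∑ k ∈ K, (r k : ℝ) * r k ≤ closePairs I x := by
    have h1 : ∑ k ∈ K, r k * r k = ∑ u ∈ I, r (fl u) := by
      rw [Finset.sum_comp r fl]; simp [r, K]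
    have h2 : ∑ u ∈ I, r (fl u) ≤ closePairs I x := by
      unfold closePairs
      rw [Finset.card_filter, Finset.sum_product]
      refine Finset.sum_le_sum fun u _ => ?_
      simp only [r]
      rw [Finset.card_filter]
      refine Finset.sum_le_sum fun v _ => ?_
      split_ifs with h3 h4
      · exact le_rfl
      · exact absurd (Int.abs_sub_lt_one_of_floor_eq_floor (h3.symm : ⌊x u⌋ = ⌊x v⌋)).le h4
      · exact zero_le_one
      · exact le_rfl
    exact_mod_cast h1.trans_le h2
  have hcomp : ∀ f : ℤ → ℝ, ∑ u ∈ I, f (fl u) = ∑ k ∈ K, (r k : ℝ) * f k := by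
    intro f
    rw [Finset.sum_comp f fl]
    simp [r, K]
  calc _ ≤ ∑ u ∈ I, ∑ v ∈ I, G (fl u - fl v) := by
        refine Finset.sum_le_sum fun u _ => Finset.sum_le_sum fun v _ => Real.exp_le_exp.mpr ?_
        have h1 : |((fl u - fl v : ℤ) : ℝ)| ≤ |x u - x v| + 1 := by
          push_cast
          have hu1 := Int.floor_le (x u)
          have hu2 := Int.lt_floor_add_one (x u)
          have hv1 := Int.floor_le (x v)
          have hv2 := Int.lt_floor_add_one (x v)
          rw [abs_le]
          constructor
          · linarith [neg_abs_le (x u - x v)]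
          · linarith [le_abs_self (x u - x v)]
        have h2 : ((fl u - fl v : ℤ) : ℝ) ^ 2 ≤ (|x u - x v| + 1) ^ 2 := by
          rw [← sq_abs ((fl u - fl v : ℤ) : ℝ)]
          gcongr
        nlinarith [sq_nonneg (|x u - x v| - 1), sq_abs (x u - x v)]
    _ = ∑ k ∈ K, ∑ l ∈ K, (r k : ℝ) * r l * G (k - l) := by
        rw [hcomp fun k => ∑ v ∈ I, G (k - fl v)]
        refine Finset.sum_congr rfl fun k _ => ?_
        rw [hcomp fun l => G (k - l), Finset.mul_sum]
        exact Finset.sum_congr rfl fun l _ => by ring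
    _ ≤ ∑ k ∈ K, ∑ l ∈ K, ((r k : ℝ) * r k * G (k - l) / 2 + (r l : ℝ) * r l * G (l - k) / 2) := by
        refine Finset.sum_le_sum fun k _ => Finset.sum_le_sum fun l _ => ?_
        rw [hGeven l k]
        nlinarith [mul_nonneg (sq_nonneg ((r k : ℝ) - r l)) (hG0 (k - l))]
    _ = ∑ k ∈ K, (r k : ℝ) * r k * ∑ l ∈ K, G (k - l) := by
        simp_rw [Finset.sum_add_distrib]
        rw [Finset.sum_comm (f := fun k l => (r l : ℝ) * r l * G (l - k) / 2),
          ← Finset.sum_add_distrib]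
        refine Finset.sum_congr rfl fun k _ => ?_
        rw [← Finset.sum_add_distrib, Finset.mul_sum]
        exact Finset.sum_congr rfl fun l _ => by ring
    _ ≤ ∑ k ∈ K, (r k : ℝ) * r k * ∑' d : ℤ, G d := by
        gcongr with k _
        exact hsum k
    _ = (∑' d : ℤ, G d) * ∑ k ∈ K, (r k : ℝ) * r k := by rw [← Finset.sum_mul, mul_comm]
    _ ≤ _ := by
        gcongr

lemma logNormal_natCast {N τ : ℝ} {n : ℕ} (hn : n ≠ 0) : logNormal N τ n =
    ((Real.exp (-(Real.log (n / N)) ^ 2) * (√n)⁻¹ : ℝ) : ℂ) * (n : ℂ) ^ ((τ : ℂ) * Complex.I) := by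
  have hn0 : (0 : ℝ) < n := by exact_mod_cast Nat.pos_of_ne_zero hn
  have hnc : ((n : ℝ) : ℂ) ≠ 0 := by exact_mod_cast hn
  rw [logNormal, if_pos hn0, Complex.cpow_add _ _ hnc]
  have e : (((n : ℝ) : ℂ)) ^ (-1 / 2 : ℂ) = (((√n)⁻¹ : ℝ) : ℂ) := by
    rw [show (-1 / 2 : ℂ) = ((-(1 / 2) : ℝ) : ℂ) by push_cast; ring,
      ← Complex.ofReal_cpow hn0.le, Real.rpow_neg hn0.le, Real.sqrt_eq_rpow]
  rw [e, Complex.ofReal_mul, Complex.ofReal_natCast]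
  ring

lemma tendsto_sum_logNormal {N : ℝ} (hN : 0 < N) (τ : ℝ) :
    Filter.Tendsto (fun L : ℕ => ∑ n ∈ (Finset.range L).erase 0, logNormal N τ (n : ℝ)) Filter.atTop
      (nhds (∑' n : ℤ, logNormal N τ n)) := by
  obtain ⟨C, _, hC⟩ := exists_norm_logNormal_le hN τ
  have hs : Summable fun n : ℤ => logNormal N τ n :=
    Summable.of_norm_bounded (summable_inv_one_add_int_sq.mul_left C) fun n => hC n
  have hn : Summable fun n : ℕ => logNormal N τ (n : ℝ) := by
    simpa [Function.comp_def] using hs.comp_injective Nat.cast_injective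
  have h0 : HasSum (fun n : ℕ => logNormal N τ ((-((n : ℤ) + 1) : ℤ) : ℝ)) 0 := by
    have : (fun n : ℕ => logNormal N τ ((-((n : ℤ) + 1) : ℤ) : ℝ)) = fun _ => 0 := by
      funext n
      rw [logNormal, if_neg]
      push_cast
      rw [not_lt]
      have : (0 : ℝ) ≤ n := by positivity
      linarith
    rw [this]
    exact hasSum_zero
  have h1 : HasSum (fun n : ℤ => logNormal N τ n) (∑' n : ℕ, logNormal N τ (n : ℝ) + 0) :=
    HasSum.of_nat_of_neg_add_one (by simpa using hn.hasSum) h0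
  rw [h1.tsum_eq, add_zero]
  refine hn.hasSum.tendsto_sum_nat.congr fun L => ?_
  rw [Finset.sum_erase]
  simp [logNormal]

/-- On (N/2, N] one has |log(n/N)| ≤ log 2 < 1, so e times the log-normal weight is at least 1. The
majorant principle concerns finite sums; it is applied to partial sums of the series before passing
to the limit. -/
lemma meanSquare_upperHalf_le {ι : Type*} (I : Finset ι) (x : ι → ℝ) {N : ℝ} (hN : 1 ≤ N) :
    meanSquare I x (upperHalf N) (fun n => (((√n)⁻¹ : ℝ) : ℂ)) ≤
      Real.exp 1 ^ 2 * ∑ u ∈ I, ∑ v ∈ I, ‖∑' n : ℤ, logNormal N (x u - x v) n‖ ^ 2 := by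
  have hN0 : 0 < N := by linarith
  have ht : Filter.Tendsto (fun L : ℕ => Real.exp 1 ^ 2 * ∑ u ∈ I, ∑ v ∈ I,
      ‖∑ n ∈ (Finset.range L).erase 0, logNormal N (x u - x v) (n : ℝ)‖ ^ 2) Filter.atTop
      (nhds (Real.exp 1 ^ 2 * ∑ u ∈ I, ∑ v ∈ I, ‖∑' n : ℤ, logNormal N (x u - x v) n‖ ^ 2)) := by
    refine Filter.Tendsto.const_mul _ ?_
    refine tendsto_finsetSum _ fun u _ => tendsto_finsetSum _ fun v _ => ?_
    exact ((tendsto_sum_logNormal hN0 _).norm).pow 2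
  refine ge_of_tendsto ht ?_
  filter_upwards [Filter.eventually_ge_atTop (⌊N⌋₊ + 1)] with L hL
  set b : ℕ → ℝ := fun n => Real.exp (-(Real.log (n / N)) ^ 2) * (√n)⁻¹ with hb
  have h1 : ∑ u ∈ I, ∑ v ∈ I,
      ‖∑ n ∈ (Finset.range L).erase 0, logNormal N (x u - x v) (n : ℝ)‖ ^ 2 =
      meanSquare I x ((Finset.range L).erase 0) (fun n => (b n : ℂ)) := by
    unfold meanSquare
    refine Finset.sum_congr rfl fun u _ => Finset.sum_congr rfl fun v _ => ?_
    congr 2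
    exact Finset.sum_congr rfl fun n hn => logNormal_natCast (Finset.ne_of_mem_erase hn)
  have h2 : Real.exp 1 ^ 2 = ‖((Real.exp 1 : ℝ) : ℂ)‖ ^ 2 := by
    rw [Complex.norm_real, Real.norm_of_nonneg (Real.exp_pos _).le]
  rw [h1, h2, ← meanSquare_const_mul]
  simp_rw [← Complex.ofReal_mul]
  refine meanSquare_le_of_norm_le I x (fun n hn => ?_) (by simp) (fun n hn => ?_)
    (fun n _ => by positivity)
  · obtain ⟨a1, a2, a3⟩ := (mem_upperHalf hN0.le).mp hn
    have : n ≤ ⌊N⌋₊ := Nat.le_floor a2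
    simp only [Finset.mem_erase, Finset.mem_range]
    omega
  · obtain ⟨a1, a2, a3⟩ := (mem_upperHalf hN0.le).mp hn
    have hn0 : (0 : ℝ) < n := by exact_mod_cast a1
    rw [Complex.norm_real, Real.norm_of_nonneg (by positivity), hb, ← mul_assoc, ← Real.exp_add]
    refine le_mul_of_one_le_left (by positivity) (Real.one_le_exp ?_)
    have hl1 : Real.log (n / N) ≤ 0 :=
      Real.log_nonpos (by positivity) ((div_le_one hN0).mpr a2)
    have hl2 : -1 ≤ Real.log (n / N) := by
      have h3 : Real.log (1 / 2) ≤ Real.log (n / N) := by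
        refine Real.log_le_log (by norm_num) ?_
        rw [le_div_iff₀ hN0]; linarith
      rw [one_div, Real.log_inv] at h3
      have := Real.log_two_lt_d9
      linarith
    nlinarith

lemma sq_integral_gaussian_mul_le (τ : ℝ) {h : ℝ → ℝ} (hc : Continuous h) {c : ℝ}
    (hb : ∀ v, |h v| ≤ c) :
    (∫ v : ℝ, Real.exp (-(1 / 4) * (τ - v) ^ 2) * h v) ^ 2 ≤
      gaussianMoment 0 * ∫ v : ℝ, Real.exp (-(1 / 4) * (τ - v) ^ 2) * h v ^ 2 := by
  set w : ℝ → ℝ := fun v => Real.exp (-(1 / 4) * (τ - v) ^ 2) with hw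
  have hwi : MeasureTheory.Integrable w := integrable_gaussian_sub τ
  have hA : ∫ v, w v = gaussianMoment 0 := by
    have := MeasureTheory.integral_sub_left_eq_self
      (fun u : ℝ => Real.exp (-(1 / 4) * u ^ 2)) MeasureTheory.volume τ
    rw [hw, this, gaussianMoment]
    simp
  have hA0 : 0 < gaussianMoment 0 := by
    have := integral_gaussian (1 / 4)
    rw [gaussianMoment]
    simp only [pow_zero, mul_one]
    rw [this]
    positivity
  have hi1 : MeasureTheory.Integrable fun v => w v * h v :=
    hwi.mul_bdd hc.aestronglyMeasurable (Filter.Eventually.of_forall hb)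
  have hi2 : MeasureTheory.Integrable fun v => w v * h v ^ 2 := by
    refine hwi.mul_bdd (c := c ^ 2) (hc.pow 2).aestronglyMeasurable
      (Filter.Eventually.of_forall fun v => ?_)
    rw [norm_pow]
    exact pow_le_pow_left₀ (norm_nonneg _) (hb v) 2
  set A := gaussianMoment 0
  set B := ∫ v, w v * h v with hB
  -- Cauchy-Schwarz for the weight w of total mass A: expanding this square gives A (A ∫ w h² - B²)
  -- ≥ 0.
  have key : 0 ≤ ∫ v, w v * (A * h v - B) ^ 2 :=
    MeasureTheory.integral_nonneg fun v => by simp only [hw, Pi.zero_apply]; positivity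
  have e : ∀ v, w v * (A * h v - B) ^ 2 =
      A ^ 2 * (w v * h v ^ 2) - 2 * A * B * (w v * h v) + B ^ 2 * w v := fun v => by ring
  simp_rw [e] at key
  have hs : MeasureTheory.Integrable fun v =>
      A ^ 2 * (w v * h v ^ 2) - 2 * A * B * (w v * h v) :=
    (hi2.const_mul _).sub (hi1.const_mul _)
  rw [MeasureTheory.integral_add hs (hwi.const_mul _),
    MeasureTheory.integral_sub (hi2.const_mul _) (hi1.const_mul _),
    MeasureTheory.integral_const_mul, MeasureTheory.integral_const_mul,
    MeasureTheory.integral_const_mul, hA, ← hB] at key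
  have : 0 ≤ A * (A * (∫ v, w v * h v ^ 2) - B ^ 2) := by nlinarith
  linarith [nonneg_of_mul_nonneg_right this hA0]

lemma continuous_norm_dirichletSum (M : ℕ) : Continuous fun v : ℝ =>
    ‖∑ n ∈ Finset.Icc 1 M, (((√n)⁻¹ : ℝ) : ℂ) * (n : ℂ) ^ ((v : ℂ) * Complex.I)‖ := by
  refine continuous_norm.comp (continuous_finsetSum _ fun n hn => ?_)
  have : (n : ℂ) ≠ 0 := by
    have := (Finset.mem_Icc.mp hn).1
    exact_mod_cast (by omega : n ≠ 0)
  exact continuous_const.mul (Continuous.const_cpow (by fun_prop) (Or.inl this))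

lemma norm_dirichletSum_le (M : ℕ) (v : ℝ) :
    |‖∑ n ∈ Finset.Icc 1 M, (((√n)⁻¹ : ℝ) : ℂ) * (n : ℂ) ^ ((v : ℂ) * Complex.I)‖| ≤
      ∑ n ∈ Finset.Icc 1 M, (√(n : ℝ))⁻¹ := by
  rw [abs_norm]
  refine (norm_sum_le _ _).trans (Finset.sum_le_sum fun n hn => ?_)
  rw [norm_mul, Complex.norm_real, Real.norm_of_nonneg (by positivity),
    Complex.norm_natCast_cpow_of_pos (Finset.mem_Icc.mp hn).1]
  simp

/-- After Cauchy-Schwarz in y, translating every difference by y only twists the coefficients by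
n^(-iy), of modulus 1. The majorant principle bounds the result by `zetaMeanSquare` uniformly in y.
-/
lemma sum_sq_integral_gaussian_le {ι : Type*} (I : Finset ι) (x : ι → ℝ) (M : ℝ) :
    ∑ u ∈ I, ∑ v ∈ I, (∫ y : ℝ, Real.exp (-(1 / 4) * (x u - x v - y) ^ 2) *
      ‖∑ n ∈ Finset.Icc 1 ⌊M⌋₊, (((√n)⁻¹ : ℝ) : ℂ) * (n : ℂ) ^ ((y : ℂ) * Complex.I)‖) ^ 2 ≤
      gaussianMoment 0 ^ 2 * zetaMeanSquare I x M := by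
  set h : ℝ → ℝ := fun y =>
    ‖∑ n ∈ Finset.Icc 1 ⌊M⌋₊, (((√n)⁻¹ : ℝ) : ℂ) * (n : ℂ) ^ ((y : ℂ) * Complex.I)‖ with hh
  have hc : Continuous h := continuous_norm_dirichletSum _
  have hb := norm_dirichletSum_le ⌊M⌋₊
  have hshift : ∀ τ : ℝ, ∫ y : ℝ, Real.exp (-(1 / 4) * (τ - y) ^ 2) * h y ^ 2 =
      ∫ y : ℝ, Real.exp (-(1 / 4) * y ^ 2) * h (τ - y) ^ 2 := by
    intro τ
    rw [← MeasureTheory.integral_sub_left_eq_self _ MeasureTheory.volume τ]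
    simp
  have hint : ∀ τ : ℝ, MeasureTheory.Integrable fun y : ℝ =>
      Real.exp (-(1 / 4) * y ^ 2) * h (τ - y) ^ 2 := by
    intro τ
    refine (integrable_exp_neg_mul_sq (b := 1 / 4) (by norm_num)).mul_bdd
      (c := (∑ n ∈ Finset.Icc 1 ⌊M⌋₊, (√(n : ℝ))⁻¹) ^ 2)
      ((hc.comp (by fun_prop)).pow 2).aestronglyMeasurable
      (Filter.Eventually.of_forall fun v => ?_)
    rw [norm_pow]
    exact pow_le_pow_left₀ (norm_nonneg _) (hb _) 2
  have hpt : ∀ y : ℝ, ∑ u ∈ I, ∑ v ∈ I, h (x u - x v - y) ^ 2 ≤ zetaMeanSquare I x M := by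
    intro y
    have e : ∑ u ∈ I, ∑ v ∈ I, h (x u - x v - y) ^ 2 = meanSquare I x (Finset.Icc 1 ⌊M⌋₊)
        (fun n => (((√n)⁻¹ : ℝ) : ℂ) * (n : ℂ) ^ (-(y : ℂ) * Complex.I)) := by
      unfold meanSquare
      refine Finset.sum_congr rfl fun u _ => Finset.sum_congr rfl fun v _ => ?_
      simp only [hh]
      congr 2
      refine Finset.sum_congr rfl fun n hn => ?_
      have : n ≠ 0 := by
        have := (Finset.mem_Icc.mp hn).1
        omega
      rw [natCast_cpow_sub_mul_I this]
      ring
    rw [e]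
    refine meanSquare_le_of_norm_le I x (Finset.Subset.refl _) (by simp) (fun n hn => ?_)
      (fun n _ => by positivity)
    rw [norm_mul, Complex.norm_real, Real.norm_of_nonneg (by positivity),
      Complex.norm_natCast_cpow_of_pos (Finset.mem_Icc.mp hn).1]
    simp
  have hg0 := gaussianMoment_nonneg 0
  calc _ ≤ ∑ u ∈ I, ∑ v ∈ I, gaussianMoment 0 *
        ∫ y : ℝ, Real.exp (-(1 / 4) * y ^ 2) * h (x u - x v - y) ^ 2 := by
        refine Finset.sum_le_sum fun u _ => Finset.sum_le_sum fun v _ => ?_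
        rw [← hshift]
        exact sq_integral_gaussian_mul_le _ hc hb
    _ = gaussianMoment 0 * ∫ y : ℝ, Real.exp (-(1 / 4) * y ^ 2) *
          ∑ u ∈ I, ∑ v ∈ I, h (x u - x v - y) ^ 2 := by
        simp_rw [← Finset.mul_sum]
        congr 1
        have e1 : ∀ u ∈ I, ∑ v ∈ I, ∫ y : ℝ, Real.exp (-(1 / 4) * y ^ 2) * h (x u - x v - y) ^ 2 =
            ∫ y : ℝ, ∑ v ∈ I, Real.exp (-(1 / 4) * y ^ 2) * h (x u - x v - y) ^ 2 := fun u _ =>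
          (MeasureTheory.integral_finsetSum _ fun v _ => hint _).symm
        rw [Finset.sum_congr rfl e1, ← MeasureTheory.integral_finsetSum _
          fun u _ => MeasureTheory.integrable_finsetSum _ fun v _ => hint _]
        simp_rw [Finset.mul_sum]
    _ ≤ gaussianMoment 0 * ∫ y : ℝ, Real.exp (-(1 / 4) * y ^ 2) * zetaMeanSquare I x M := by
        refine mul_le_mul_of_nonneg_left ?_ hg0
        refine MeasureTheory.integral_mono_of_nonneg (Filter.Eventually.of_forall fun y => ?_)
          ((integrable_exp_neg_mul_sq (b := 1 / 4) (by norm_num)).mul_const _)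
          (Filter.Eventually.of_forall fun y => ?_)
        · simp only [Pi.zero_apply]; positivity
        · exact mul_le_mul_of_nonneg_left (hpt y) (Real.exp_pos _).le
    _ = _ := by
        rw [MeasureTheory.integral_mul_const, gaussianMoment]
        simp only [pow_zero, mul_one]
        ring

/-- The reflection principle in mean square. -/
lemma exists_meanSquare_upperHalf_le {ι : Type*} (i : ℕ) : ∃ C : ℝ, 0 < C ∧
    ∀ (I : Finset ι) (x : ι → ℝ) (N T Q : ℝ), 1 ≤ N → 1 ≤ T → 0 < Q → T ^ 2 ≤ Q ^ i →
      (∀ u ∈ I, ∀ v ∈ I, |x u - x v| ≤ T) →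
      meanSquare I x (upperHalf N) (fun n => (((√n)⁻¹ : ℝ) : ℂ)) ≤
        C * (N * closePairs I x + (I.card : ℝ) ^ 2 + zetaMeanSquare I x (T * Q / N)) := by
  obtain ⟨C, hC, h⟩ := exists_norm_tsum_logNormal_le i
  set S : ℝ := ∑' d : ℤ, Real.exp (1 / 2 - (d : ℝ) ^ 2 / 4)
  have hS : 0 ≤ S := tsum_nonneg fun _ => (Real.exp_pos _).le
  set g := gaussianMoment 0 ^ 2
  have hg : 0 ≤ g := sq_nonneg _
  refine ⟨Real.exp 1 ^ 2 * (3 * C ^ 2 * (S + 1 + g)), by positivity, ?_⟩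
  intro I x N T Q hN hT hQ hTQ hx
  have hN0 : 0 < N := by linarith
  refine (meanSquare_upperHalf_le I x hN).trans ?_
  rw [mul_assoc]
  refine mul_le_mul_of_nonneg_left ?_ (by positivity)
  set J : ℝ → ℝ := fun τ => ∫ y : ℝ, Real.exp (-(1 / 4) * (τ - y) ^ 2) *
      ‖∑ n ∈ Finset.Icc 1 ⌊T * Q / N⌋₊, (((√n)⁻¹ : ℝ) : ℂ) * (n : ℂ) ^ ((y : ℂ) * Complex.I)‖
      with hJ
  have hpt : ∀ u ∈ I, ∀ v ∈ I, ‖∑' n : ℤ, logNormal N (x u - x v) n‖ ^ 2 ≤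
      3 * C ^ 2 * (N * Real.exp (-(1 / 2) * (x u - x v) ^ 2) + 1 + J (x u - x v) ^ 2) := by
    intro u hu v hv
    set τ := x u - x v with hτ
    have h1 := h N T Q τ hN hT hQ hTQ (hx u hu v hv)
    have h2 : (√N * Real.exp (-(1 / 4) * τ ^ 2)) ^ 2 = N * Real.exp (-(1 / 2) * τ ^ 2) := by
      rw [mul_pow, Real.sq_sqrt hN0.le, ← Real.exp_nat_mul]
      congr 2
      push_cast
      ring
    rw [← h2]
    refine (pow_le_pow_left₀ (norm_nonneg _) h1 2).trans ?_
    set G := √N * Real.exp (-(1 / 4) * τ ^ 2)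
    rw [mul_pow, mul_comm 3 (C ^ 2), mul_assoc]
    refine mul_le_mul_of_nonneg_left ?_ (by positivity)
    nlinarith [sq_nonneg (G - 1), sq_nonneg (G - J τ), sq_nonneg (1 - J τ)]
  refine (Finset.sum_le_sum fun u hu => Finset.sum_le_sum fun v hv => hpt u hu v hv).trans ?_
  simp_rw [← Finset.mul_sum, Finset.sum_add_distrib, ← Finset.mul_sum]
  rw [mul_assoc (3 * C ^ 2)]
  refine mul_le_mul_of_nonneg_left ?_ (by positivity)
  have a1 := sum_gaussian_le_closePairs I x
  have a2 := sum_sq_integral_gaussian_le I x (T * Q / N)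
  have a3 : ∑ u ∈ I, ∑ v ∈ I, (1 : ℝ) = (I.card : ℝ) ^ 2 := by simp [sq]
  rw [a3]
  set U := zetaMeanSquare I x (T * Q / N)
  have hU : 0 ≤ U := zetaMeanSquare_nonneg ..
  have hE : (0 : ℝ) ≤ closePairs I x := by positivity
  set E : ℝ := (closePairs I x : ℝ)
  have hW : 0 ≤ (I.card : ℝ) ^ 2 := by positivity
  set W := (I.card : ℝ) ^ 2
  calc _ ≤ N * (S * E) + W + g * U := by gcongr
    _ ≤ _ := by
      have p1 := mul_nonneg hN0.le hE
      nlinarith [mul_nonneg hS hW, mul_nonneg hS hU, mul_nonneg hg hW, mul_nonneg hg p1]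

/-! ### Reflection and squaring with losses of the form L^ε. -/

lemma exists_zetaMeanSquare_le_reflected {ι : Type*} {ε : ℝ} (hε : 0 < ε) : ∃ C : ℝ, 1 ≤ C ∧
    ∀ (I : Finset ι) (x : ι → ℝ) (L N T : ℝ), 1 ≤ L → 1 ≤ N → N ≤ L ^ 2 → 1 ≤ T → T ≤ L →
      (∀ u ∈ I, ∀ v ∈ I, |x u - x v| ≤ T) →
      zetaMeanSquare I x N ≤ C * L ^ ε * (N * closePairs I x + (I.card : ℝ) ^ 2 +
        zetaMeanSquare I x (T * L ^ ε / N)) := by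
  -- As N ≤ L², the divisor bound and the logarithm each cost L^(2δ), together L^ε.
  set δ := ε / 4 with hδ
  have hδ0 : 0 < δ := by positivity
  obtain ⟨Cd, hCd1, hCd⟩ := exists_card_divisors_le_rpow hδ0
  -- This i ensures T² ≤ L² ≤ (L^ε)^i, so Q = L^ε is admissible in the reflection.
  obtain ⟨i, hi⟩ := exists_nat_ge (2 / ε)
  obtain ⟨Cr, hCr0, hCr⟩ := exists_meanSquare_upperHalf_le (ι := ι) i
  set C₀ := 16 * (1 + 1 / δ) * Cd * Cr with hC₀
  refine ⟨C₀ + 1, by have : 0 < C₀ := by positivity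
                     linarith, ?_⟩
  intro I x L N T hL hN hNL hT hTL hx
  have hN0 : 0 < N := by linarith
  have hL0 : 0 < L := by linarith
  have hQ0 : 0 < L ^ ε := by positivity
  have hNδ : N ^ δ ≤ L ^ (2 * δ) := by
    rw [mul_comm, Real.rpow_mul hL0.le, Real.rpow_two, Real.rpow_pow_comm hL0.le]
    gcongr
  have hD : ∀ n : ℕ, n ≠ 0 → (n : ℝ) ≤ N → (n.divisors.card : ℝ) ≤ Cd * L ^ (2 * δ) := by
    intro n hn hnN
    refine (hCd n hn).trans ?_
    gcongr
    exact le_trans (by gcongr) hNδ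
  have h1 := zetaMeanSquare_le_upperHalf I x hN hD
  have hTQ : T ^ 2 ≤ (L ^ ε) ^ i := by
    rw [← Real.rpow_natCast (L ^ ε), ← Real.rpow_mul hL0.le]
    calc T ^ 2 ≤ L ^ 2 := by gcongr
      _ = L ^ (2 : ℝ) := (Real.rpow_two L).symm
      _ ≤ _ := by
          refine Real.rpow_le_rpow_of_exponent_le hL ?_
          rwa [div_le_iff₀' hε] at hi
  have h2 := hCr I x N T (L ^ ε) hN hT hQ0 hTQ hx
  have hlog : 1 + Real.log N ≤ (1 + 1 / δ) * L ^ (2 * δ) := by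
    have h3 : Real.log N ≤ N ^ δ / δ := Real.log_le_rpow_div hN0.le hδ0
    have h4 : 1 ≤ N ^ δ := Real.one_le_rpow hN hδ0.le
    calc 1 + Real.log N ≤ N ^ δ + N ^ δ / δ := add_le_add h4 h3
      _ = (1 + 1 / δ) * N ^ δ := by ring
      _ ≤ _ := by gcongr
  have hLL : L ^ (2 * δ) * L ^ (2 * δ) = L ^ ε := by
    rw [← Real.rpow_add hL0]; congr 1; rw [hδ]; ring
  set X := N * closePairs I x + (I.card : ℝ) ^ 2 + zetaMeanSquare I x (T * L ^ ε / N)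
  have hX : 0 ≤ X := by
    have := zetaMeanSquare_nonneg I x (T * L ^ ε / N)
    positivity
  have hlog0 : 0 ≤ Real.log N := Real.log_nonneg hN
  calc _ ≤ 16 * (1 + Real.log N) * (Cd * L ^ (2 * δ)) * (Cr * X) := by
        refine h1.trans ?_
        gcongr
    _ ≤ 16 * ((1 + 1 / δ) * L ^ (2 * δ)) * (Cd * L ^ (2 * δ)) * (Cr * X) := by gcongr
    _ = C₀ * (L ^ (2 * δ) * L ^ (2 * δ)) * X := by rw [hC₀]; ring
    _ ≤ _ := by
        rw [hLL]
        gcongr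
        linarith

lemma exists_zetaMeanSquare_sq_le {ι : Type*} {ε : ℝ} (hε : 0 < ε) : ∃ C : ℝ, 1 ≤ C ∧
    ∀ (I : Finset ι) (x : ι → ℝ) (L M : ℝ), 1 ≤ L → 0 ≤ M → M ≤ L ^ 2 →
      zetaMeanSquare I x M ^ 2 ≤
        C * L ^ ε * ((I.card : ℝ) ^ 2 * zetaMeanSquare I x (M ^ 2)) := by
  -- The integers involved are at most M² ≤ L⁴, and the divisor bound enters squared: 2 · 4δ = ε.
  set δ := ε / 8 with hδ
  have hδ0 : 0 < δ := by positivity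
  obtain ⟨Cd, hCd1, hCd⟩ := exists_card_divisors_le_rpow hδ0
  refine ⟨Cd ^ 2, one_le_pow₀ hCd1, ?_⟩
  intro I x L M hL hM hML
  have hL0 : 0 < L := by linarith
  have hLδ : (L ^ 4) ^ δ = L ^ (4 * δ) := by
    rw [Real.rpow_mul hL0.le]; norm_cast
  have hD : ∀ n : ℕ, n ≠ 0 → (n : ℝ) ≤ M ^ 2 → (n.divisors.card : ℝ) ≤ Cd * L ^ (4 * δ) := by
    intro n hn hnM
    refine (hCd n hn).trans ?_
    rw [← hLδ]
    gcongr
    calc (n : ℝ) ≤ M ^ 2 := hnM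
      _ ≤ (L ^ 2) ^ 2 := by gcongr
      _ = L ^ 4 := by ring
  refine (zetaMeanSquare_sq_le I x hM hD).trans (le_of_eq ?_)
  have : (L ^ (4 * δ)) ^ 2 = L ^ ε := by
    rw [← Real.rpow_natCast, ← Real.rpow_mul hL0.le]
    congr 1
    rw [hδ]; push_cast; ring
  rw [mul_pow, this]
  ring

/-! ### Combining reflection with squaring. -/

/-- A monotone function with a reflection and a squaring inequality is small beyond the
length `T ^ (2 / 3)`, where `T = t ^ 3`. -/
lemma le_of_reflection_of_squaring {U : ℝ → ℝ} (hU : Monotone U) (hU0 : ∀ y, 0 ≤ U y)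
    {P Q t L E W : ℝ} (hQ : 1 ≤ Q) (hQP : Q ≤ P) (ht : 1 ≤ t) (hE : 0 ≤ E)
    (hL : 1 ≤ L) (hTL : t ^ 3 * Q ≤ L)
    (hR : ∀ N, 1 ≤ N → N ≤ L ^ 2 → U N ≤ P * (N * E + W ^ 2 + U (t ^ 3 * Q / N)))
    (hB : ∀ M, 0 ≤ M → M ≤ L ^ 2 → U M ^ 2 ≤ P * (W ^ 2 * U (M ^ 2)))
    {N : ℝ} (hN : N ≤ L ^ 2) : U N ≤ 3 * P ^ 4 * (W ^ 2 + max N 0 * E + t ^ 2 * E) := by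
  have hP : 1 ≤ P := hQ.trans hQP
  have hP0 : 0 < P := by linarith
  have hQ0 : 0 < Q := by linarith
  have ht0 : 0 < t := by linarith
  -- Enlarging N to N' ≥ t²Q makes the square of the dual length, (t³Q/N')², at most N', so squaring
  -- leads back to U N' itself.
  set N' := max (max N 0) (t ^ 2 * Q) with hN'
  have hLL : L ≤ L ^ 2 := by nlinarith
  have htQ : t ^ 2 * Q ≤ L := by
    refine le_trans ?_ hTL
    gcongr
    norm_num
  have htQ1 : 1 ≤ t ^ 2 * Q := by nlinarith [one_le_pow₀ ht (n := 2)]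
  have h1 : 1 ≤ N' := htQ1.trans (le_max_right _ _)
  have hN'0 : 0 < N' := by linarith
  have h2 : N' ≤ L ^ 2 := max_le (max_le hN (by positivity)) (htQ.trans hLL)
  have h3 := hR N' h1 h2
  set V := U (t ^ 3 * Q / N') with hV
  have hV0 : 0 ≤ V := hU0 _
  have h4 : V ^ 2 ≤ P * (W ^ 2 * U N') := by
    refine (hB _ (by positivity) ?_).trans ?_
    · calc t ^ 3 * Q / N' ≤ t ^ 3 * Q := div_le_self (by positivity) h1
        _ ≤ L ^ 2 := hTL.trans hLL
    · gcongr
      refine hU ?_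
      rw [div_pow, div_le_iff₀ (by positivity)]
      have h5 : (t ^ 2 * Q) ^ 3 ≤ N' ^ 3 := by gcongr; exact le_max_right _ _
      have h6 : (t ^ 3 * Q) ^ 2 ≤ (t ^ 2 * Q) ^ 3 := by
        have : (t ^ 2 * Q) ^ 3 = (t ^ 3 * Q) ^ 2 * Q := by ring
        rw [this]
        exact le_mul_of_one_le_right (by positivity) hQ
      calc _ ≤ N' ^ 3 := h6.trans h5
        _ = _ := by ring
  have hUN0 : 0 ≤ U N' := hU0 _
  -- By the arithmetic-geometric mean inequality half of U N' is absorbed on the left.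
  have h5 : P * V ≤ (U N' + P ^ 3 * W ^ 2) / 2 := by
    refine abs_le_of_sq_le_sq' ?_ (by positivity) |>.2
    have : (P * V) ^ 2 ≤ P ^ 3 * W ^ 2 * U N' := by
      calc (P * V) ^ 2 = P ^ 2 * V ^ 2 := by ring
        _ ≤ P ^ 2 * (P * (W ^ 2 * U N')) := by gcongr
        _ = _ := by ring
    nlinarith [sq_nonneg (U N' - P ^ 3 * W ^ 2)]
  have h6 : U N' ≤ 2 * P * (N' * E + W ^ 2) + P ^ 3 * W ^ 2 := by
    nlinarith
  have hPP : P ≤ P ^ 3 := le_self_pow₀ hP (by norm_num)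
  have h7 : U N' ≤ 3 * P ^ 3 * (N' * E + W ^ 2) := by
    have hx : 0 ≤ N' * E + W ^ 2 := by positivity
    have hy : 0 ≤ P ^ 3 * (N' * E) := by positivity
    nlinarith [mul_le_mul_of_nonneg_right hPP hx]
  have h8 : N' ≤ P * (max N 0 + t ^ 2) := by
    have hm : 0 ≤ max N 0 := le_max_right _ _
    refine max_le ?_ ?_
    · nlinarith [mul_nonneg hP0.le (sq_nonneg t)]
    · nlinarith [mul_nonneg hP0.le hm, mul_le_mul_of_nonneg_right hQP (sq_nonneg t)]
  calc U N ≤ U N' := hU ((le_max_left _ _).trans (le_max_left _ _))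
    _ ≤ _ := h7
    _ ≤ 3 * P ^ 3 * (P * (max N 0 + t ^ 2) * E + P * W ^ 2) := by
        gcongr
        exact le_mul_of_one_le_left (by positivity) hP
    _ = _ := by ring

/-- The short-range version of `le_of_reflection_of_squaring`: the dual length is optimised by
passing first to the length `Z / E`. -/
lemma le_of_reflection_of_squaring' {U : ℝ → ℝ} (hU : Monotone U) (hU0 : ∀ y, 0 ≤ U y)
    {P Q t L E W Z : ℝ} (hQ : 1 ≤ Q) (hQP : Q ≤ P) (ht : 1 ≤ t) (hE : 0 < E)
    (hL : 1 ≤ L) (hTL : t ^ 3 * Q ≤ L)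
    (hR : ∀ N, 1 ≤ N → N ≤ L ^ 2 → U N ≤ P * (N * E + W ^ 2 + U (t ^ 3 * Q / N)))
    (hB : ∀ M, 0 ≤ M → M ≤ L ^ 2 → U M ^ 2 ≤ P * (W ^ 2 * U (M ^ 2)))
    (hZ : 0 ≤ Z) (hZ4 : Z ^ 4 = t ^ 6 * W ^ 2 * E ^ 3)
    {N : ℝ} (hN1 : 1 ≤ N) (hN : N ≤ L ^ 2) : U N ≤ 6 * P ^ 5 * (W ^ 2 + N * E + Z) := by
  have hP : 1 ≤ P := hQ.trans hQP
  have hP0 : 0 < P := by linarith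
  have hQ0 : 0 < Q := by linarith
  have ht0 : 0 < t := by linarith
  have hH := @le_of_reflection_of_squaring U hU hU0 P Q t L E W hQ hQP ht hE.le hL hTL hR hB
  have hP45 : P ^ 4 ≤ P ^ 5 := pow_le_pow_right₀ hP (by norm_num)
  have hP15 : P ≤ P ^ 5 := le_self_pow₀ hP (by norm_num)
  have hNE : 0 ≤ N * E := by positivity
  -- If t²E ≤ W², the previous lemma already suffices. Otherwise Z ≤ t²E and W² t²E ≤ Z², which the
  -- argument below needs.
  rcases le_or_gt (t ^ 2 * E) (W ^ 2) with hc | hc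
  · have h1 := hH hN
    rw [max_eq_left (by linarith)] at h1
    calc U N ≤ _ := h1
      _ ≤ 3 * P ^ 5 * (W ^ 2 + N * E + W ^ 2) := by gcongr
      _ ≤ 3 * P ^ 5 * (2 * (W ^ 2 + N * E + Z)) := by
          gcongr
          linarith
      _ = _ := by ring
  · have hLL : L ≤ L ^ 2 := by nlinarith
    have ht3L : t ^ 3 ≤ L := (le_mul_of_one_le_right (by positivity) hQ).trans hTL
    -- K balances the direct term ME against the dual term W (t³/M) E^(1/2) at M = K: this means K⁴E
    -- = t⁶W², equivalent to Z⁴ = t⁶W²E³.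
    set K := Z / E with hK
    have hKE : K * E = Z := div_mul_cancel₀ _ hE.ne'
    have hK0 : 0 ≤ K := by positivity
    have hZt : Z ≤ t ^ 2 * E := by
      refine le_of_pow_le_pow_left₀ (n := 4) (by norm_num) (by positivity) ?_
      rw [hZ4]
      calc t ^ 6 * W ^ 2 * E ^ 3 ≤ t ^ 6 * (t ^ 2 * E) * E ^ 3 := by gcongr
        _ = _ := by ring
    have hKt : K ≤ t ^ 2 := (div_le_iff₀ hE).mpr hZt
    set M := max N K with hM
    have hM1 : 1 ≤ M := hN1.trans (le_max_left _ _)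
    have hM0 : 0 < M := by linarith
    have hML : M ≤ L ^ 2 := by
      refine max_le hN (hKt.trans (le_trans ?_ (ht3L.trans hLL)))
      gcongr
      norm_num
    have h1 := hR M hM1 hML
    set V := U (t ^ 3 * Q / M)
    have hV0 : 0 ≤ V := hU0 _
    have hy0 : 0 ≤ t ^ 3 * Q / M := by positivity
    have hyL : t ^ 3 * Q / M ≤ L := (div_le_self (by positivity) hM1).trans hTL
    have h2 : V ^ 2 ≤ P * (W ^ 2 * U ((t ^ 3 * Q / M) ^ 2)) := hB _ hy0 (hyL.trans hLL)
    have h3 := hH (N := (t ^ 3 * Q / M) ^ 2) (by gcongr)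
    rw [max_eq_left (by positivity)] at h3
    have hWZ : W ^ 2 * (t ^ 3 / M) ^ 2 * E ≤ Z ^ 2 := by
      rcases hZ.eq_or_lt with h0 | h0
      · have hz : t ^ 6 * W ^ 2 * E ^ 3 = 0 := by rw [← hZ4, ← h0]; norm_num
        have hW0 : W ^ 2 = 0 := by
          have h5 : t ^ 6 ≠ 0 := by positivity
          have h6 : E ^ 3 ≠ 0 := by positivity
          simpa [h5, h6] using hz
        rw [hW0]
        simp [sq_nonneg]
      · have hKpos : 0 < K := div_pos h0 hE
        calc W ^ 2 * (t ^ 3 / M) ^ 2 * E ≤ W ^ 2 * (t ^ 3 / K) ^ 2 * E := by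
              gcongr
              exact le_max_right _ _
          _ = t ^ 6 * W ^ 2 * E ^ 3 / Z ^ 2 := by
              rw [hK]; field_simp
          _ = Z ^ 2 := by rw [← hZ4]; field_simp
    have hWt : W ^ 2 * (t ^ 2 * E) ≤ Z ^ 2 := by
      refine le_of_pow_le_pow_left₀ (n := 2) (by norm_num) (by positivity) ?_
      calc (W ^ 2 * (t ^ 2 * E)) ^ 2 = W ^ 2 * (t ^ 4 * E ^ 2) * W ^ 2 := by ring
        _ ≤ W ^ 2 * (t ^ 4 * E ^ 2) * (t ^ 2 * E) := by gcongr
        _ = Z ^ 4 := by rw [hZ4]; ring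
        _ = (Z ^ 2) ^ 2 := by ring
    have h4 : V ≤ 3 * P ^ 4 * (W ^ 2 + Z) := by
      refine abs_le_of_sq_le_sq' ?_ (by positivity) |>.2
      have hQ2 : Q ^ 2 ≤ P ^ 2 := by gcongr
      have hP2 : 1 ≤ P ^ 2 := one_le_pow₀ hP
      have hP78 : P ^ 7 ≤ P ^ 8 := pow_le_pow_right₀ hP (by norm_num)
      have hin : W ^ 2 * (W ^ 2 + (t ^ 3 * Q / M) ^ 2 * E + t ^ 2 * E) ≤
          P ^ 2 * (W ^ 4 + 2 * Z ^ 2) := by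
        calc _ = W ^ 4 + Q ^ 2 * (W ^ 2 * (t ^ 3 / M) ^ 2 * E) + W ^ 2 * (t ^ 2 * E) := by ring
          _ ≤ P ^ 2 * W ^ 4 + P ^ 2 * Z ^ 2 + P ^ 2 * Z ^ 2 := by
              refine add_le_add (add_le_add ?_ ?_) ?_
              · exact le_mul_of_one_le_left (by positivity) hP2
              · gcongr
              · exact hWt.trans (le_mul_of_one_le_left (by positivity) hP2)
          _ = _ := by ring
      calc V ^ 2 ≤ P * (W ^ 2 * (3 * P ^ 4 *
            (W ^ 2 + (t ^ 3 * Q / M) ^ 2 * E + t ^ 2 * E))) := by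
              refine h2.trans ?_
              gcongr
        _ = 3 * P ^ 5 * (W ^ 2 * (W ^ 2 + (t ^ 3 * Q / M) ^ 2 * E + t ^ 2 * E)) := by ring
        _ ≤ 3 * P ^ 5 * (P ^ 2 * (W ^ 4 + 2 * Z ^ 2)) := by gcongr
        _ = P ^ 7 * (3 * W ^ 4 + 6 * Z ^ 2) := by ring
        _ ≤ P ^ 8 * (3 * W ^ 4 + 6 * Z ^ 2) := by gcongr
        _ ≤ P ^ 8 * (9 * (W ^ 2 + Z) ^ 2) := by
            gcongr
            nlinarith [mul_nonneg (sq_nonneg W) hZ, sq_nonneg (W ^ 2), sq_nonneg Z]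
        _ = _ := by ring
    have hME : M * E ≤ N * E + Z := by
      rw [← hKE, ← add_mul]
      gcongr
      exact max_le (by linarith) (by linarith)
    calc U N ≤ U M := hU (le_max_left _ _)
      _ ≤ P * ((N * E + Z) + W ^ 2 + 3 * P ^ 4 * (W ^ 2 + Z)) := by
          refine h1.trans ?_
          gcongr
      _ = P * (W ^ 2 + N * E + Z) + 3 * P ^ 5 * (W ^ 2 + Z) := by ring
      _ ≤ P ^ 5 * (W ^ 2 + N * E + Z) + 3 * P ^ 5 * (W ^ 2 + N * E + Z) := by
          gcongr
          linarith
      _ ≤ _ := by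
          have : 0 ≤ P ^ 5 * (W ^ 2 + N * E + Z) := by positivity
          linarith

/-- Weighted form of Heath-Brown's mean value estimate for Dirichlet polynomials over the
differences of a family of points. -/
lemma exists_zetaMeanSquare_le {ι : Type*} {ε : ℝ} (hε : 0 < ε) (hε1 : ε ≤ 1 / 2) :
    ∃ C : ℝ, 1 ≤ C ∧ ∀ (I : Finset ι) (x : ι → ℝ) (L N T : ℝ), 1 ≤ N → N ≤ L → 1 ≤ T → T ≤ L →
      (∀ u ∈ I, ∀ v ∈ I, |x u - x v| ≤ T) →
      zetaMeanSquare I x N ≤ C * L ^ (10 * ε) * ((I.card : ℝ) ^ 2 + N * closePairs I x +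
        T ^ (2 / 3 : ℝ) * closePairs I x) ∧
      zetaMeanSquare I x N ≤ C * L ^ (10 * ε) * ((I.card : ℝ) ^ 2 + N * closePairs I x +
        T ^ (1 / 2 : ℝ) * (I.card : ℝ) ^ (1 / 2 : ℝ) * (closePairs I x : ℝ) ^ (3 / 4 : ℝ)) := by
  obtain ⟨C₁, hC₁, h₁⟩ := exists_zetaMeanSquare_le_reflected (ι := ι) hε
  obtain ⟨C₂, hC₂, h₂⟩ := exists_zetaMeanSquare_sq_le (ι := ι) hε
  set C₀ := max C₁ C₂
  have hC₀ : 1 ≤ C₀ := hC₁.trans (le_max_left _ _)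
  refine ⟨6 * C₀ ^ 5, by linarith [one_le_pow₀ hC₀ (n := 5)], ?_⟩
  intro I x L N T hN hNL hT hTL hx
  have hT0 : 0 < T := by linarith
  have hL1 : 1 ≤ L := hT.trans hTL
  have hL0 : 0 < L := by linarith
  have hLL : L ≤ L ^ 2 := by nlinarith
  have hLL4 : L ^ 2 ≤ (L ^ 2) ^ 2 := by nlinarith [one_le_pow₀ hL1 (n := 2)]
  -- The two inequalities are used with L² in place of L, which leaves room for TQ ≤ L²; this is
  -- where ε ≤ 1/2 enters, through Q ≤ L.
  set Q := (L ^ 2) ^ ε with hQ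
  have hL21 : 1 ≤ L ^ 2 := one_le_pow₀ hL1
  have hQ1 : 1 ≤ Q := Real.one_le_rpow hL21 hε.le
  have hQL : Q ≤ L := by
    calc Q ≤ (L ^ 2) ^ (1 / 2 : ℝ) := Real.rpow_le_rpow_of_exponent_le hL21 hε1
      _ = L := by rw [← Real.sqrt_eq_rpow, Real.sqrt_sq hL0.le]
  have hQ5 : Q ^ 5 = L ^ (10 * ε) := by
    rw [hQ, ← Real.rpow_natCast, ← Real.rpow_mul (by positivity), ← Real.rpow_natCast,
      ← Real.rpow_mul hL0.le]
    congr 1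
    push_cast; ring
  set P := C₀ * Q with hP
  have hQP : Q ≤ P := le_mul_of_one_le_left (by linarith) hC₀
  have hP1 : 1 ≤ P := hQ1.trans hQP
  have hP5 : 6 * P ^ 5 = 6 * C₀ ^ 5 * L ^ (10 * ε) := by rw [hP, mul_pow, hQ5]; ring
  set t := T ^ (1 / 3 : ℝ) with ht
  have ht1 : 1 ≤ t := Real.one_le_rpow hT (by norm_num)
  have ht3 : t ^ 3 = T := by
    rw [ht, ← Real.rpow_natCast, ← Real.rpow_mul hT0.le]; norm_num
  have ht2 : t ^ 2 = T ^ (2 / 3 : ℝ) := by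
    rw [ht, ← Real.rpow_natCast, ← Real.rpow_mul hT0.le]; norm_num
  set U := zetaMeanSquare I x with hU
  set E : ℝ := (closePairs I x : ℝ) with hE
  set W : ℝ := (I.card : ℝ) with hW
  have hE0 : 0 ≤ E := Nat.cast_nonneg _
  have hW0 : 0 ≤ W := Nat.cast_nonneg _
  have hUm : Monotone U := fun a b h => zetaMeanSquare_mono I x h
  have hUn : ∀ y, 0 ≤ U y := fun y => zetaMeanSquare_nonneg I x y
  have hTQ : t ^ 3 * Q ≤ L ^ 2 := by
    rw [ht3, sq]
    gcongr
  have hR : ∀ N, 1 ≤ N → N ≤ (L ^ 2) ^ 2 → U N ≤ P * (N * E + W ^ 2 + U (t ^ 3 * Q / N)) := by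
    intro N hN hN2
    rw [ht3]
    refine (h₁ I x (L ^ 2) N T hL21 hN hN2 hT (hTL.trans hLL) hx).trans ?_
    refine mul_le_mul_of_nonneg_right ?_ ?_
    · exact mul_le_mul_of_nonneg_right (le_max_left _ _) (by linarith)
    · have := hUn (T * Q / N)
      positivity
  have hB : ∀ M, 0 ≤ M → M ≤ (L ^ 2) ^ 2 → U M ^ 2 ≤ P * (W ^ 2 * U (M ^ 2)) := by
    intro M hM hM2
    refine (h₂ I x (L ^ 2) M hL21 hM hM2).trans ?_
    refine mul_le_mul_of_nonneg_right ?_ ?_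
    · exact mul_le_mul_of_nonneg_right (le_max_right _ _) (by linarith)
    · have := hUn (M ^ 2)
      positivity
  have hNL2 : N ≤ (L ^ 2) ^ 2 := hNL.trans (hLL.trans hLL4)
  constructor
  · have h := le_of_reflection_of_squaring hUm hUn hQ1 hQP ht1 hE0 hL21 hTQ hR hB hNL2
    rw [max_eq_left (by linarith), ht2] at h
    refine h.trans ?_
    rw [← hP5]
    refine mul_le_mul_of_nonneg_right ?_ (by positivity)
    have : P ^ 4 ≤ P ^ 5 := pow_le_pow_right₀ hP1 (by norm_num)
    have h5 : 0 ≤ P ^ 5 := by positivity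
    linarith
  · set Z := T ^ (1 / 2 : ℝ) * W ^ (1 / 2 : ℝ) * E ^ (3 / 4 : ℝ) with hZ
    have hZ0 : 0 ≤ Z := by positivity
    rw [← hP5]
    rcases hE0.eq_or_lt with h0 | h0
    -- `closePairs` includes the diagonal, so it vanishes only for an empty family. The case is
    -- separate because the balancing divides by E.
    · have hI : I = ∅ := by
        have hc : closePairs I x = 0 := by
          have h0' : (closePairs I x : ℝ) = 0 := h0.symm
          exact_mod_cast h0'
        rw [closePairs, Finset.card_eq_zero] at hc
        refine Finset.eq_empty_of_forall_notMem fun u hu => ?_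
        have : (u, u) ∈ (I ×ˢ I).filter fun p => |x p.1 - x p.2| ≤ 1 := by simp [hu]
        rw [hc] at this
        simp at this
      have hUN : U N = 0 := by simp [hU, zetaMeanSquare, meanSquare, hI]
      rw [hUN]
      positivity
    · refine le_of_reflection_of_squaring' hUm hUn hQ1 hQP ht1 h0 hL21 hTQ hR hB hZ0 ?_ hN hNL2
      have a1 : (T ^ (1 / 2 : ℝ)) ^ 4 = t ^ 6 := by
        rw [show t ^ 6 = (t ^ 3) ^ 2 by ring, ht3, ← Real.rpow_natCast, ← Real.rpow_mul hT0.le]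
        norm_num
      have a2 : (W ^ (1 / 2 : ℝ)) ^ 4 = W ^ 2 := by
        rw [← Real.rpow_natCast, ← Real.rpow_mul hW0]; norm_num
      have a3 : (E ^ (3 / 4 : ℝ)) ^ 4 = E ^ 3 := by
        rw [← Real.rpow_natCast, ← Real.rpow_mul hE0]; norm_num
      rw [hZ, mul_pow, mul_pow, a1, a2, a3]

/-! ### Application to the sums of k elements of A. -/

lemma additiveEnergy_eq_closePairs (k : ℕ) (A : Finset ℝ) :
    additiveEnergy k A = closePairs (tuples A k) (fun u => ∑ i, u i) := rfl

/-- The majorant principle replaces a_n by 1 and extends the range from [N, 2N] to [1, 2N]. -/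
lemma convolutionMeanValue_le_zetaMeanSquare (k : ℕ) (A : Finset ℝ) {a : ℕ → ℂ}
    (ha : ∀ n, ‖a n‖ ≤ 1) {N : ℝ} (hN : 1 ≤ N) :
    convolutionMeanValue k A a N ≤
      zetaMeanSquare (tuples A k) (fun u => ∑ i, u i) (2 * N) := by
  have hpos : ∀ n ∈ Finset.Icc ⌈N⌉₊ ⌊2 * N⌋₊, 0 < n := fun n hn =>
    (Nat.ceil_pos.mpr (by linarith)).trans_le (Finset.mem_Icc.mp hn).1
  have h1 : convolutionMeanValue k A a N = meanSquare (tuples A k) (fun u => ∑ i, u i)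
      (Finset.Icc ⌈N⌉₊ ⌊2 * N⌋₊) (fun n => a n * (((√n)⁻¹ : ℝ) : ℂ)) := by
    unfold convolutionMeanValue meanSquare dirichletPoly
    refine Finset.sum_congr rfl fun u _ => Finset.sum_congr rfl fun v _ => ?_
    congr 2
    refine Finset.sum_congr rfl fun n hn => ?_
    have hn0 : (n : ℂ) ≠ 0 := by exact_mod_cast (hpos n hn).ne'
    rw [Complex.cpow_add _ _ hn0, mul_assoc]
    congr 2
    rw [show (-1 / 2 : ℂ) = ((-(1 / 2) : ℝ) : ℂ) by push_cast; ring, ← Complex.ofReal_natCast,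
      ← Complex.ofReal_cpow (by positivity), Real.rpow_neg (by positivity), Real.sqrt_eq_rpow]
  rw [h1]
  refine meanSquare_le_of_norm_le _ _ (fun n hn => ?_) (by simp) (fun n hn => ?_)
    (fun n _ => by positivity)
  · exact Finset.mem_Icc.mpr ⟨hpos n hn, (Finset.mem_Icc.mp hn).2⟩
  · rw [norm_mul, Complex.norm_real, Real.norm_of_nonneg (by positivity)]
    exact mul_le_of_le_one_left (by positivity) (ha n)

lemma abs_sum_sub_sum_le {k : ℕ} {A : Finset ℝ} {T : ℝ} (hA : (A : Set ℝ) ⊆ Set.Icc 0 T)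
    {u v : Fin k → ℝ} (hu : u ∈ tuples A k) (hv : v ∈ tuples A k) :
    |(∑ i, u i) - ∑ i, v i| ≤ k * T := by
  have h : ∀ w ∈ tuples A k, 0 ≤ ∑ i, w i ∧ ∑ i, w i ≤ k * T := by
    intro w hw
    have hw' : ∀ i, w i ∈ Set.Icc 0 T := fun i => hA (Fintype.mem_piFinset.mp hw i)
    refine ⟨Finset.sum_nonneg fun i _ => (hw' i).1, ?_⟩
    calc ∑ i, w i ≤ ∑ _i : Fin k, T := Finset.sum_le_sum fun i _ => (hw' i).2
      _ = _ := by simp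
  have hu' := h u hu
  have hv' := h v hv
  rw [abs_le]
  constructor <;> linarith

lemma exists_convolutionMeanValue_le {k : ℕ} (hk : 1 ≤ k) {ε : ℝ} (hε : 0 < ε) :
    ∃ C : ℝ, 0 < C ∧ ∀ (N T : ℝ), 1 ≤ N → 1 ≤ T →
      ∀ A : Finset ℝ, (A : Set ℝ) ⊆ Set.Icc 0 T → ∀ a : ℕ → ℂ, (∀ n, ‖a n‖ ≤ 1) →
        convolutionMeanValue k A a N ≤ C * (N * T) ^ ε * ((A.card : ℝ) ^ (2 * k) +
          N * (additiveEnergy k A : ℝ) + T ^ (2 / 3 : ℝ) * (additiveEnergy k A : ℝ)) ∧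
        convolutionMeanValue k A a N ≤ C * (N * T) ^ ε * ((A.card : ℝ) ^ (2 * k) +
          N * (additiveEnergy k A : ℝ) + T ^ (1 / 2 : ℝ) * (A.card : ℝ) ^ ((k : ℝ) / 2) *
              (additiveEnergy k A : ℝ) ^ (3 / 4 : ℝ)) := by
  set δ := min (ε / 10) (1 / 2) with hδ
  have hδ0 : 0 < δ := lt_min (by positivity) (by norm_num)
  obtain ⟨C, hC1, hC⟩ := exists_zetaMeanSquare_le (ι := Fin k → ℝ) hδ0 (min_le_right _ _)
  have hk1 : (1 : ℝ) ≤ k := by exact_mod_cast hk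
  have hk0 : (0 : ℝ) < k := by linarith
  refine ⟨C * (2 * k) ^ (10 * δ) * (2 * k), by positivity, ?_⟩
  intro N T hN hT A hA a ha
  have hN0 : 0 < N := by linarith
  have hT0 : 0 < T := by linarith
  have hNT : 1 ≤ N * T := one_le_mul_of_one_le_of_one_le hN hT
  have hcard : ((tuples A k).card : ℝ) = (A.card : ℝ) ^ k := by
    simp [tuples]
  have hS := convolutionMeanValue_le_zetaMeanSquare k A ha hN
  -- Differences of sums of k elements of [0, T] are at most kT, and L = 2kNT exceeds both kT and
  -- the length 2N. The powers of k that arise go into the constant.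
  have h := hC (tuples A k) (fun u => ∑ i, u i) (2 * k * (N * T)) (2 * N) (k * T) (by linarith)
    (by nlinarith [mul_nonneg hN0.le (sub_nonneg.mpr hT),
          mul_nonneg (mul_pos hN0 hT0).le (sub_nonneg.mpr hk1)])
    (one_le_mul_of_one_le_of_one_le hk1 hT)
    (by nlinarith [mul_pos hk0 hT0, mul_nonneg (mul_pos hk0 hT0).le (sub_nonneg.mpr hN)])
    (fun u hu v hv => abs_sum_sub_sum_le hA hu hv)
  rw [← additiveEnergy_eq_closePairs, hcard, ← pow_mul, mul_comm k 2] at h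
  set E : ℝ := (additiveEnergy k A : ℝ)
  set W : ℝ := (A.card : ℝ) with hW
  have hE : 0 ≤ E := Nat.cast_nonneg _
  have hW0 : 0 ≤ W := Nat.cast_nonneg _
  have hWk : (W ^ k) ^ (1 / 2 : ℝ) = W ^ ((k : ℝ) / 2) := by
    rw [← Real.rpow_natCast, ← Real.rpow_mul hW0, mul_one_div]
  have hL : (2 * k * (N * T)) ^ (10 * δ) ≤ (2 * k) ^ (10 * δ) * (N * T) ^ ε := by
    rw [Real.mul_rpow (by positivity) (by positivity)]
    gcongr
    have := min_le_left (ε / 10) (1 / 2 : ℝ)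
    rw [← hδ] at this
    linarith
  have hkle : ∀ s : ℝ, s ≤ 1 → (k : ℝ) ^ s ≤ 2 * k := fun s hs => by
    calc (k : ℝ) ^ s ≤ (k : ℝ) ^ (1 : ℝ) := Real.rpow_le_rpow_of_exponent_le hk1 hs
      _ ≤ 2 * k := by rw [Real.rpow_one]; linarith
  have hW2 : 0 ≤ W ^ (2 * k) := by positivity
  have hNE : 0 ≤ N * E := by positivity
  have key : ∀ s X : ℝ, s ≤ 1 → 0 ≤ X →
      C * (2 * k * (N * T)) ^ (10 * δ) * (W ^ (2 * k) + 2 * N * E + (k : ℝ) ^ s * X) ≤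
      C * (2 * k) ^ (10 * δ) * (2 * k) * (N * T) ^ ε * (W ^ (2 * k) + N * E + X) := by
    intro s X hs hX
    have h1 : W ^ (2 * k) + 2 * N * E + (k : ℝ) ^ s * X ≤ 2 * k * (W ^ (2 * k) + N * E + X) := by
      have b1 := mul_le_mul_of_nonneg_right (hkle s hs) hX
      have b2 : W ^ (2 * k) ≤ 2 * k * W ^ (2 * k) := le_mul_of_one_le_left hW2 (by linarith)
      have b3 : 2 * (N * E) ≤ 2 * k * (N * E) := by gcongr; linarith
      linarith
    calc _ ≤ C * ((2 * k) ^ (10 * δ) * (N * T) ^ ε) *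
          (2 * k * (W ^ (2 * k) + N * E + X)) := by gcongr
      _ = _ := by ring
  constructor
  · refine hS.trans (h.1.trans ?_)
    rw [Real.mul_rpow hk0.le hT0.le, mul_assoc ((k : ℝ) ^ (2 / 3 : ℝ))]
    exact key _ _ (by norm_num) (by positivity)
  · refine hS.trans (h.2.trans ?_)
    rw [Real.mul_rpow hk0.le hT0.le, hWk, mul_assoc ((k : ℝ) ^ (1 / 2 : ℝ)),
      mul_assoc ((k : ℝ) ^ (1 / 2 : ℝ))]
    exact key _ _ (by norm_num) (by positivity)

theorem theorem17 (k : ℕ) (hk : 1 ≤ k) :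
    (∀ ε : ℝ, 0 < ε → ∀ B : ℝ, 0 < B → ∃ C : ℝ, 0 < C ∧
      ∀ (N T : ℝ), 1 ≤ N → 1 ≤ T → T ≤ N ^ B →
      ∀ A : Finset ℝ, (A : Set ℝ) ⊆ Set.Icc 0 T → IsWellSpaced A →
      ∀ a : ℕ → ℂ, (∀ n, ‖a n‖ ≤ 1) →
        convolutionMeanValue k A a N ≤
          C * N ^ ε * ((A.card : ℝ) ^ (2 * k) + N * (additiveEnergy k A : ℝ) +
            T ^ (1 / 2 : ℝ) * (A.card : ℝ) ^ ((k : ℝ) / 2) *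
              (additiveEnergy k A : ℝ) ^ (3 / 4 : ℝ))) ∧
    (∀ ε : ℝ, 0 < ε → ∃ C : ℝ, 0 < C ∧
      ∀ (N T : ℝ), 1 ≤ N → 1 ≤ T →
      ∀ A : Finset ℝ, (A : Set ℝ) ⊆ Set.Icc 0 T → IsWellSpaced A →
      ∀ a : ℕ → ℂ, (∀ n, ‖a n‖ ≤ 1) →
        (T ^ (2 / 3 : ℝ) ≤ N ∨
          T ^ (2 / 3 : ℝ) * (additiveEnergy k A : ℝ) ≤ (A.card : ℝ) ^ (2 * k)) →
        convolutionMeanValue k A a N ≤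
          C * (N * T) ^ ε * ((A.card : ℝ) ^ (2 * k) + N * (additiveEnergy k A : ℝ))) := by
  constructor
  · intro ε hε B hB
    -- Since NT ≤ N^(1 + B), the exponent ε/(1 + B) turns (NT)-losses into N^ε.
    obtain ⟨C, hC, h⟩ := exists_convolutionMeanValue_le hk (ε := ε / (1 + B)) (by positivity)
    refine ⟨C, hC, fun N T hN hT hTN A hA _ a ha => ((h N T hN hT A hA a ha).2).trans ?_⟩
    have hN0 : 0 < N := by linarith
    have hT0 : 0 < T := by linarith
    have h1 : (N * T) ^ (ε / (1 + B)) ≤ N ^ ε := by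
      calc (N * T) ^ (ε / (1 + B)) ≤ (N * N ^ B) ^ (ε / (1 + B)) := by gcongr
        _ = N ^ ε := by
            rw [← Real.rpow_one_add' hN0.le (by positivity), ← Real.rpow_mul hN0.le]
            congr 1
            field_simp
    gcongr
  · intro ε hε
    obtain ⟨C, hC, h⟩ := exists_convolutionMeanValue_le hk hε
    refine ⟨2 * C, by positivity, fun N T hN hT A hA _ a ha hcase =>
      ((h N T hN hT A hA a ha).1).trans ?_⟩
    have hN0 : 0 < N := by linarith
    have hT0 : 0 < T := by linarith
    set E : ℝ := (additiveEnergy k A : ℝ)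
    have hE : 0 ≤ E := Nat.cast_nonneg _
    have hNE : 0 ≤ N * E := by positivity
    have hW : 0 ≤ (A.card : ℝ) ^ (2 * k) := by positivity
    -- Each alternative of the hypothesis absorbs the term T^(2/3) E into one of the two main terms.
    have h1 : T ^ (2 / 3 : ℝ) * E ≤ (A.card : ℝ) ^ (2 * k) + N * E := by
      rcases hcase with h2 | h2
      · have := mul_le_mul_of_nonneg_right h2 hE
        linarith
      · linarith
    calc _ ≤ C * (N * T) ^ ε * (2 * ((A.card : ℝ) ^ (2 * k) + N * E)) := by
          gcongr
          linarith
      _ = _ := by ring
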